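/- Let $f(x,d)=f_1(x)+f_2(x)d$ with $f_1:\mathbb{R}^n\to\mathbb{R}^n$ and $f_2:\mathbb{R}^n\to\mathbb{R}^{n\times m}$, and let $\mathcal{D}\subseteq\mathbb{R}^m$ be compact and convex. Assume that $f$ is locally Lipschitz in $x$ uniformly over $d\in\mathcal{D}$: for each compact $K\subseteq\mathbb{R}^n$ there is $L$ with $\|f(x,d)-f(y,d)\|\le L\|x-y\|$ for all $x,y\in K$ and $d\in\mathcal{D}$. Let $\mathcal{M}$ be the set of measurable functions $d:[0,\infty)\to\mathcal{D}$. For $x_0\in\mathbb{R}^n$ and $d\in\mathcal{M}$ let $\phi_{x_0}^{d}:[0,\tau)\to\mathbb{R}^n$, $0<\tau\le\infty$, be the trajectory of $\dot x=f(x,d(t))$, $x(0)=x_0$, that is, the solution $\phi(t)=x_0+\int_0^t f(\phi(s),d(s))\,ds$ on its maximal interval of existence. Let $\mathcal{S}=\{x\in\mathbb{R}^n : h(x)<0\}$ be open and bounded, with $h:\mathbb{R}^n\to\mathbb{R}$ locally Lipschitz, let $\mathcal{X}_0\subseteq\mathcal{S}$ be compact, and let $0<T<\infty$. The system is called safe over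 $[0,T]$ if for all $x_0\in\mathcal{X}_0$ and all $d\in\mathcal{M}$ the trajectory $\phi_{x_0}^{d}$ is defined on all of $[0,T]$ and $\phi_{x_0}^{d}(t)\in\mathcal{S}$ for all $t\in[0,T]$. Then the system is safe over $[0,T]$ if and only if there is a time-dependent barrier certificate, that is, a continuously differentiable function $v:\mathbb{R}^n\times[0,T]\to\mathbb{R}$ (with one-sided time derivatives at $t=0$ and $t=T$) such that $$v(x,0)<0\quad\text{for all }x\in\mathcal{X}_0,$$ $$v(x,t)\ge 0\quad\text{for all }(x,t)\in\partial\mathcal{S}\times[0,T],$$ $$\frac{\partial v}{\partial t}(x,t)+\frac{\partial v}{\partial x}(x,t)\,f(x,d)\le 0\quad\text{for all }(x,d,t)\in\overline{\mathcal{S}}\times\mathcal{D}\times[0,T].$$ -/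

import Mathlib

open Set MeasureTheory

/-- The vector field `f(x, d) = f₁(x) + f₂(x) d`, where `f₂(x)` is an `n × m` matrix, given as a
linear map from `ℝᵐ` to `ℝⁿ`. -/
def affineField {n m : ℕ}
    (f₁ : EuclideanSpace ℝ (Fin n) → EuclideanSpace ℝ (Fin n))
    (f₂ : EuclideanSpace ℝ (Fin n) → (EuclideanSpace ℝ (Fin m) →L[ℝ] EuclideanSpace ℝ (Fin n)))
    (x : EuclideanSpace ℝ (Fin n)) (d : EuclideanSpace ℝ (Fin m)) : EuclideanSpace ℝ (Fin n) :=
  f₁ x + f₂ x d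

/-- `f(x, d)` is locally Lipschitz in `x`, uniformly over `d ∈ D`. -/
def LocallyLipschitzUniformly {n m : ℕ}
    (f : EuclideanSpace ℝ (Fin n) → EuclideanSpace ℝ (Fin m) → EuclideanSpace ℝ (Fin n))
    (D : Set (EuclideanSpace ℝ (Fin m))) : Prop :=
  ∀ K : Set (EuclideanSpace ℝ (Fin n)), IsCompact K →
    ∃ L : ℝ, ∀ x ∈ K, ∀ y ∈ K, ∀ d ∈ D, ‖f x d - f y d‖ ≤ L * ‖x - y‖

/-- Admissible disturbances: measurable functions with values in `D` on `[0, ∞)`. The values at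
negative times play no role. -/
def Disturbances {m : ℕ} (D : Set (EuclideanSpace ℝ (Fin m))) :
    Set (ℝ → EuclideanSpace ℝ (Fin m)) :=
  {d | Measurable d ∧ ∀ t : ℝ, 0 ≤ t → d t ∈ D}

/-- `φ` is a (Carathéodory) solution of `ẋ = f(x, d(t))`, `x(0) = x₀`, on `[0, τ)`, where
`τ ∈ (0, ∞]`: the integral form of the equation, which makes `φ` locally absolutely continuous with
`φ' = f(φ, d)` almost everywhere. The values of `φ` outside `[0, τ)` play no role. -/
structure IsSolution {n m : ℕ}
    (f : EuclideanSpace ℝ (Fin n) → EuclideanSpace ℝ (Fin m) → EuclideanSpace ℝ (Fin n))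
    (d : ℝ → EuclideanSpace ℝ (Fin m)) (x₀ : EuclideanSpace ℝ (Fin n))
    (τ : EReal) (φ : ℝ → EuclideanSpace ℝ (Fin n)) : Prop where
  pos : 0 < τ
  integrable : ∀ t : ℝ, 0 ≤ t → (t : EReal) < τ →
    IntervalIntegrable (fun s => f (φ s) (d s)) volume 0 t
  eq_integral : ∀ t : ℝ, 0 ≤ t → (t : EReal) < τ →
    φ t = x₀ + ∫ s in (0 : ℝ)..t, f (φ s) (d s)

/-- `φ` on `[0, τ)` is the trajectory from `x₀` under `d`, and `[0, τ)` is its maximal interval of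
existence: no solution on a longer interval extends it. -/
structure IsTrajectory {n m : ℕ}
    (f : EuclideanSpace ℝ (Fin n) → EuclideanSpace ℝ (Fin m) → EuclideanSpace ℝ (Fin n))
    (d : ℝ → EuclideanSpace ℝ (Fin m)) (x₀ : EuclideanSpace ℝ (Fin n))
    (τ : EReal) (φ : ℝ → EuclideanSpace ℝ (Fin n)) : Prop where
  isSolution : IsSolution f d x₀ τ φ
  maximal : ∀ (τ' : EReal) (φ' : ℝ → EuclideanSpace ℝ (Fin n)), IsSolution f d x₀ τ' φ' →
    (∀ t : ℝ, 0 ≤ t → (t : EReal) < τ → φ' t = φ t) → τ' ≤ τ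

/-- Safety over `[0, T]`: from every `x₀ ∈ X₀` and under every admissible disturbance, the
trajectory is defined on all of `[0, T]` and stays in `S` there. (For the vector fields considered
here the trajectory exists and is unique.) -/
def IsSafe {n m : ℕ}
    (f : EuclideanSpace ℝ (Fin n) → EuclideanSpace ℝ (Fin m) → EuclideanSpace ℝ (Fin n))
    (D : Set (EuclideanSpace ℝ (Fin m))) (X₀ S : Set (EuclideanSpace ℝ (Fin n))) (T : ℝ) : Prop :=
  ∀ x₀ ∈ X₀, ∀ d ∈ Disturbances D,
    ∀ (τ : EReal) (φ : ℝ → EuclideanSpace ℝ (Fin n)), IsTrajectory f d x₀ τ φ →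
      ∀ t ∈ Icc (0 : ℝ) T, (t : EReal) < τ ∧ φ t ∈ S

/-- `v` is a time-dependent barrier certificate: continuously differentiable on `ℝⁿ × [0, T]`
(one-sided in time at the end points) and subject to the three conditions. -/
structure IsBarrierCertificate {n m : ℕ}
    (f : EuclideanSpace ℝ (Fin n) → EuclideanSpace ℝ (Fin m) → EuclideanSpace ℝ (Fin n))
    (D : Set (EuclideanSpace ℝ (Fin m))) (X₀ S : Set (EuclideanSpace ℝ (Fin n))) (T : ℝ)
    (v : EuclideanSpace ℝ (Fin n) → ℝ → ℝ) : Prop where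
  contDiffOn : ContDiffOn ℝ 1 (fun p : EuclideanSpace ℝ (Fin n) × ℝ => v p.1 p.2)
    (univ ×ˢ Icc (0 : ℝ) T)
  neg_initial : ∀ x ∈ X₀, v x 0 < 0
  nonneg_frontier : ∀ x ∈ frontier S, ∀ t ∈ Icc (0 : ℝ) T, 0 ≤ v x t
  derivative_nonpos : ∀ x ∈ closure S, ∀ d ∈ D, ∀ t ∈ Icc (0 : ℝ) T,
    derivWithin (fun s => v x s) (Icc (0 : ℝ) T) t + fderiv ℝ (fun y => v y t) x (f x d) ≤ 0

/-! Only the values of the field on the compact set `closure S` matter, so it may be replaced by a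
field that is bounded by `B` and `L`-Lipschitz in the state on the whole space.

From safety to a certificate: the certificate is a smoothed measure of how far a point of space-time
is from being reachable. Starting in `X₀ × {0}`, Euler steps of length at most `η` are free and
arbitrary jumps are charged by their size; `jumpCost` is the infimum of the charge. It is
nonpositive on `X₀ × {0}`, it is 1-Lipschitz because a jump can always be appended, and it does not
increase along Euler steps because a step can be appended for free. Safety enters in
`IsSafe.exists_margin`: for some `η` the cost is at least some `δ > 0` over the boundary of `S`.
Otherwise pseudo-orbits with `η` and cost tending to zero would reach the boundary, and a limit of
them would be a trajectory that touches the boundary by time `T`. Compactness and convexity of `D`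
ensure that the limit is driven by an admissible disturbance. Mollifying at scale `ε` changes the
cost by at most `ε` and lets it grow along the field at rate at most `L * ε`; subtracting `L * ε * t
+ δ / 2` restores all three conditions.

From a certificate to safety: `IsBarrierCertificate.apply_le` shows that `v` does not increase along
a solution in `closure S`. It is negative initially and nonnegative on the boundary, so there is no
first exit. A trajectory confined to a bounded set cannot end in finite time, by
`IsTrajectory.eq_top_of_bounded`. -/

open Filter Topology
open scoped Pointwise

/-! ### Truncation to a bounded, globally Lipschitz field. -/

section AffineFields

variable {E : Type*} [NormedAddCommGroup E]

/-- A cutoff function equal to one on the ball of radius `R`, zero off the ball of radius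
`R + 1`. -/
def radialCutoff (R : ℝ) (x : E) : ℝ := max 0 (min 1 (R + 1 - ‖x‖))

lemma radialCutoff_nonneg (R : ℝ) (x : E) : 0 ≤ radialCutoff R x := le_max_left _ _

lemma radialCutoff_le_one (R : ℝ) (x : E) : radialCutoff R x ≤ 1 :=
  max_le zero_le_one (min_le_left _ _)

lemma radialCutoff_eq_one {R : ℝ} {x : E} (hx : ‖x‖ ≤ R) : radialCutoff R x = 1 := by
  unfold radialCutoff
  rw [min_eq_left (by linarith), max_eq_right zero_le_one]

lemma radialCutoff_eq_zero {R : ℝ} {x : E} (hx : R + 1 ≤ ‖x‖) : radialCutoff R x = 0 := by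
  unfold radialCutoff
  rw [max_eq_left]
  exact (min_le_right _ _).trans (by linarith)

lemma abs_radialCutoff_sub_le (R : ℝ) (x y : E) :
    |radialCutoff R x - radialCutoff R y| ≤ ‖x - y‖ := by
  unfold radialCutoff
  calc |max 0 (min 1 (R + 1 - ‖x‖)) - max 0 (min 1 (R + 1 - ‖y‖))|
      ≤ |min 1 (R + 1 - ‖x‖) - min 1 (R + 1 - ‖y‖)| := by
        simpa [max_comm] using
          abs_max_sub_max_le_abs (min 1 (R + 1 - ‖x‖)) (min 1 (R + 1 - ‖y‖)) 0
    _ ≤ max |(1 : ℝ) - 1| |(R + 1 - ‖x‖) - (R + 1 - ‖y‖)| := abs_min_sub_min_le_max _ _ _ _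
    _ ≤ ‖x - y‖ := by
        refine max_le (by simp) ?_
        have : (R + 1 - ‖x‖) - (R + 1 - ‖y‖) = -(‖x‖ - ‖y‖) := by ring
        rw [this, abs_neg]
        exact abs_norm_sub_norm_le x y

variable [NormedSpace ℝ E] {W : Type*} [NormedAddCommGroup W] [NormedSpace ℝ W]

/-- The control-affine field `x ↦ F₁ x + F₂ x d` is bounded by `B` and `L`-Lipschitz in `x`,
uniformly over `d ∈ D`. -/
structure IsBoundedLipschitz (F₁ : E → E) (F₂ : E → W →L[ℝ] E) (D : Set W) (B L : ℝ) : Prop where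
  bound_nonneg : 0 ≤ B
  lip_nonneg : 0 ≤ L
  bound : ∀ x, ∀ d ∈ D, ‖F₁ x + F₂ x d‖ ≤ B
  lip : ∀ x y, ∀ d ∈ D, ‖(F₁ x + F₂ x d) - (F₁ y + F₂ y d)‖ ≤ L * ‖x - y‖

/-- The constant `M + L` is the product rule: the cutoff is 1-Lipschitz and multiplies something of
size `M`. If one point lies outside the large ball, the cutoff vanishes there, and its value at the
other point is at most the distance; nothing is needed about the field outside. -/
lemma IsBoundedLipschitz.cutoff {f₁ : E → E} {f₂ : E → W →L[ℝ] E} {D : Set W} {R L M : ℝ}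
    (hL : 0 ≤ L) (hM : 0 ≤ M)
    (hb : ∀ x, ‖x‖ ≤ R + 1 → ∀ d ∈ D, ‖f₁ x + f₂ x d‖ ≤ M)
    (hl : ∀ x y, ‖x‖ ≤ R + 1 → ‖y‖ ≤ R + 1 → ∀ d ∈ D,
      ‖(f₁ x + f₂ x d) - (f₁ y + f₂ y d)‖ ≤ L * ‖x - y‖) :
    IsBoundedLipschitz (fun x => radialCutoff R x • f₁ x) (fun x => radialCutoff R x • f₂ x) D M
      (M + L) := by
  have key : ∀ x d, radialCutoff R x • f₁ x + (radialCutoff R x • f₂ x) d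
      = radialCutoff R x • (f₁ x + f₂ x d) := fun x d => by simp [smul_add]
  have far : ∀ x y, ‖x‖ ≤ R + 1 → R + 1 ≤ ‖y‖ → ∀ d ∈ D,
      ‖radialCutoff R x • (f₁ x + f₂ x d)‖ ≤ (M + L) * ‖x - y‖ := by
    intro x y hx hy d hd
    have h1 := abs_radialCutoff_sub_le R x y
    rw [radialCutoff_eq_zero hy, sub_zero] at h1
    rw [norm_smul, Real.norm_eq_abs]
    calc _ ≤ ‖x - y‖ * M := mul_le_mul h1 (hb x hx d hd) (norm_nonneg _) (norm_nonneg _)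
      _ ≤ _ := by nlinarith [norm_nonneg (x - y)]
  refine ⟨hM, add_nonneg hM hL, fun x d hd => ?_, fun x y d hd => ?_⟩
  · rw [key, norm_smul, Real.norm_eq_abs, abs_of_nonneg (radialCutoff_nonneg R x)]
    rcases le_total ‖x‖ (R + 1) with hx | hx
    · calc _ ≤ 1 * M := mul_le_mul (radialCutoff_le_one R x) (hb x hx d hd) (norm_nonneg _)
            zero_le_one
        _ = M := one_mul M
    · rw [radialCutoff_eq_zero hx, zero_mul]; exact hM
  · rw [key, key]
    rcases le_total ‖x‖ (R + 1) with hx | hx <;> rcases le_total ‖y‖ (R + 1) with hy | hy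
    · have e : radialCutoff R x • (f₁ x + f₂ x d) - radialCutoff R y • (f₁ y + f₂ y d)
          = (radialCutoff R x - radialCutoff R y) • (f₁ x + f₂ x d)
            + radialCutoff R y • ((f₁ x + f₂ x d) - (f₁ y + f₂ y d)) := by
        rw [sub_smul, smul_sub]; abel
      rw [e]
      refine (norm_add_le _ _).trans ?_
      rw [norm_smul, norm_smul, Real.norm_eq_abs, Real.norm_eq_abs,
        abs_of_nonneg (radialCutoff_nonneg R y), add_mul]
      refine add_le_add ?_ ?_
      · rw [mul_comm M]
        exact mul_le_mul (abs_radialCutoff_sub_le R x y) (hb x hx d hd) (norm_nonneg _)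
          (norm_nonneg _)
      · calc _ ≤ 1 * (L * ‖x - y‖) := mul_le_mul (radialCutoff_le_one R y) (hl x y hx hy d hd)
              (norm_nonneg _) zero_le_one
          _ = _ := one_mul _
    · rw [radialCutoff_eq_zero hy, zero_smul, sub_zero]
      exact far x y hx hy d hd
    · rw [radialCutoff_eq_zero hx, zero_smul, zero_sub, norm_neg, norm_sub_rev]
      exact far y x hy hx d hd
    · rw [radialCutoff_eq_zero hx, radialCutoff_eq_zero hy]
      simp only [zero_smul, sub_zero, norm_zero]
      exact mul_nonneg (add_nonneg hM hL) (norm_nonneg _)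

/-- A locally Lipschitz control-affine field agrees on any given ball with a globally bounded and
Lipschitz one. -/
lemma LocallyLipschitzUniformly.exists_isBoundedLipschitz {n m : ℕ}
    {f₁ : EuclideanSpace ℝ (Fin n) → EuclideanSpace ℝ (Fin n)}
    {f₂ : EuclideanSpace ℝ (Fin n) → (EuclideanSpace ℝ (Fin m) →L[ℝ] EuclideanSpace ℝ (Fin n))}
    {D : Set (EuclideanSpace ℝ (Fin m))} (hf : LocallyLipschitzUniformly (affineField f₁ f₂) D)
    (hD : IsCompact D) (R : ℝ) :
    ∃ F₁ F₂ B L, IsBoundedLipschitz F₁ F₂ D B L ∧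
      ∀ x, ‖x‖ ≤ R → F₁ x = f₁ x ∧ F₂ x = f₂ x := by
  obtain ⟨L, hL⟩ := hf (Metric.closedBall 0 (max (R + 1) 0)) (isCompact_closedBall _ _)
  obtain ⟨C, hC⟩ := hD.isBounded.exists_norm_le
  set R' := max (R + 1) 0
  have hl : ∀ x y, ‖x‖ ≤ R' → ‖y‖ ≤ R' → ∀ d ∈ D,
      ‖(f₁ x + f₂ x d) - (f₁ y + f₂ y d)‖ ≤ max L 0 * ‖x - y‖ := fun x y hx hy d hd =>
    (hL x (by simpa using hx) y (by simpa using hy) d hd).trans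
      (mul_le_mul_of_nonneg_right (le_max_left _ _) (norm_nonneg _))
  have hR' : 0 ≤ R' := le_max_right _ _
  have hR1 : R + 1 ≤ R' := le_max_left _ _
  refine ⟨_, _, _, _, IsBoundedLipschitz.cutoff (f₁ := f₁) (f₂ := f₂) (R := R) (L := max L 0)
    (M := ‖f₁ 0‖ + ‖f₂ 0‖ * max C 0 + max L 0 * R') (le_max_right _ _) (by positivity)
    (fun x hx d hd => ?_) (fun x y hx hy => hl x y (hx.trans hR1) (hy.trans hR1)),
    fun x hx => by simp [radialCutoff_eq_one hx]⟩
  have h1 := hl x 0 (hx.trans hR1) (by simpa using hR') d hd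
  have h2 : ‖f₂ 0 d‖ ≤ ‖f₂ 0‖ * max C 0 :=
    ((f₂ 0).le_opNorm d).trans
      (mul_le_mul_of_nonneg_left ((hC d hd).trans (le_max_left _ _)) (norm_nonneg _))
  have h3 : max L 0 * ‖x - 0‖ ≤ max L 0 * R' := by
    rw [sub_zero]
    exact mul_le_mul_of_nonneg_left (hx.trans hR1) (le_max_right _ _)
  calc ‖f₁ x + f₂ x d‖ = ‖((f₁ x + f₂ x d) - (f₁ 0 + f₂ 0 d)) + (f₁ 0 + f₂ 0 d)‖ := by simp
    _ ≤ _ := norm_add_le _ _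
    _ ≤ _ := by linarith [norm_add_le (f₁ 0) (f₂ 0 d)]

end AffineFields

/-! ### Pseudo-orbits and the continuous curves that shadow them. -/

section PseudoOrbits

variable {E W : Type*} [NormedAddCommGroup E] [NormedSpace ℝ E]
  [NormedAddCommGroup W] [NormedSpace ℝ W]
  {F₁ : E → E} {F₂ : E → W →L[ℝ] E} {D : Set W} {B L η : ℝ} {X₀ : Set E}

/-- `PseudoOrbit F₁ F₂ D X₀ η z c`: the point `z` of space-time is reached from `X₀ × {0}` by
finitely many Euler steps of length at most `η` and jumps of total size `c`. -/
inductive PseudoOrbit (F₁ : E → E) (F₂ : E → W →L[ℝ] E) (D : Set W) (X₀ : Set E) (η : ℝ) :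
    E × ℝ → ℝ → Prop
  | start (x : E) (hx : x ∈ X₀) : PseudoOrbit F₁ F₂ D X₀ η (x, 0) 0
  | step (z : E × ℝ) (c : ℝ) (d : W) (h : ℝ) (hz : PseudoOrbit F₁ F₂ D X₀ η z c) (hd : d ∈ D)
      (h0 : 0 ≤ h) (hη : h ≤ η) :
      PseudoOrbit F₁ F₂ D X₀ η (z + h • (F₁ z.1 + F₂ z.1 d, (1 : ℝ))) c
  | jump (z e : E × ℝ) (c : ℝ) (hz : PseudoOrbit F₁ F₂ D X₀ η z c) :
      PseudoOrbit F₁ F₂ D X₀ η (z + e) (c + ‖e‖)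

lemma PseudoOrbit.cost_nonneg {z : E × ℝ} {c : ℝ} (h : PseudoOrbit F₁ F₂ D X₀ η z c) : 0 ≤ c := by
  induction h with
  | start => exact le_rfl
  | step _ _ _ _ _ _ _ _ ih => exact ih
  | jump _ e _ _ ih => exact add_nonneg ih (norm_nonneg e)

/-- `φ` is on `[0, σ]`, up to an error of size `ε` in the velocity, a trajectory driven by the
derivative of `Δ`. -/
structure IsApproxTrajectory (F₁ : E → E) (F₂ : E → W →L[ℝ] E) (D : Set W) (B L ε σ : ℝ)
    (φ : ℝ → E) (Δ : ℝ → W) : Prop where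
  nonneg : 0 ≤ σ
  control_zero : Δ 0 = 0
  control : ∀ a b, 0 ≤ a → a ≤ b → b ≤ σ → Δ b - Δ a ∈ (b - a) • D
  speed : ∀ a b, 0 ≤ a → a ≤ b → b ≤ σ → ‖φ b - φ a‖ ≤ B * (b - a)
  defect : ∀ a b, 0 ≤ a → a ≤ b → b ≤ σ →
    ‖φ b - φ a - ((b - a) • F₁ (φ a) + F₂ (φ a) (Δ b - Δ a))‖ ≤ (b - a) * (L * (ε + B * (b - a)))

lemma IsApproxTrajectory.mono (hF : IsBoundedLipschitz F₁ F₂ D B L) {ε ε' σ : ℝ} {φ : ℝ → E}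
    {Δ : ℝ → W} (h : IsApproxTrajectory F₁ F₂ D B L ε σ φ Δ) (hε : ε ≤ ε') :
    IsApproxTrajectory F₁ F₂ D B L ε' σ φ Δ := by
  refine ⟨h.nonneg, h.control_zero, h.control, h.speed, fun a b ha hab hb =>
    (h.defect a b ha hab hb).trans ?_⟩
  have := hF.lip_nonneg
  gcongr

/-- The curve is continued with the constant velocity that the field has at `x`, not at its own
endpoint `φ σ`. The resulting velocity error is `L` times the distance from `x`, which is at most
`c` at the endpoint and grows by at most `B * h`; this is the budget `ε`. -/
lemma IsApproxTrajectory.extend (hF : IsBoundedLipschitz F₁ F₂ D B L) (hDc : Convex ℝ D)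
    {c ε σ h : ℝ} {x : E} {d : W} {φ : ℝ → E} {Δ : ℝ → W}
    (H : IsApproxTrajectory F₁ F₂ D B L ε σ φ Δ) (hd : d ∈ D) (h0 : 0 ≤ h)
    (hx : ‖φ σ - x‖ ≤ c) (hcε : c + B * h ≤ ε) :
    ∃ φ' Δ', φ' 0 = φ 0 ∧ φ' (σ + h) = φ σ + h • (F₁ x + F₂ x d) ∧
      IsApproxTrajectory F₁ F₂ D B L ε (σ + h) φ' Δ' := by
  have hB := hF.bound_nonneg
  have hL := hF.lip_nonneg
  set G := F₁ x + F₂ x d with hG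
  have hGB : ‖G‖ ≤ B := hF.bound x d hd
  let φ' : ℝ → E := fun r => if r ≤ σ then φ r else φ σ + (r - σ) • G
  let Δ' : ℝ → W := fun r => if r ≤ σ then Δ r else Δ σ + (r - σ) • d
  have φl : ∀ r, r ≤ σ → φ' r = φ r := fun r hr => if_pos hr
  have Δl : ∀ r, r ≤ σ → Δ' r = Δ r := fun r hr => if_pos hr
  have φr : ∀ r, σ ≤ r → φ' r = φ σ + (r - σ) • G := by
    intro r hr
    rcases hr.eq_or_lt with rfl | hr
    · simp [φ']
    · exact if_neg hr.not_ge
  have Δr : ∀ r, σ ≤ r → Δ' r = Δ σ + (r - σ) • d := by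
    intro r hr
    rcases hr.eq_or_lt with rfl | hr
    · simp [Δ']
    · exact if_neg hr.not_ge
  have speedr : ∀ r, σ ≤ r → ‖(r - σ) • G‖ ≤ B * (r - σ) := by
    intro r hr
    rw [norm_smul, Real.norm_eq_abs, abs_of_nonneg (by linarith), mul_comm]
    exact mul_le_mul_of_nonneg_right hGB (by linarith)
  have lipG : ∀ y, ‖G - (F₁ y + F₂ y d)‖ ≤ L * ‖x - y‖ := fun y => hF.lip x y d hd
  have hσ := H.nonneg
  refine ⟨φ', Δ', φl 0 hσ, ?_, ⟨by linarith, ?_, ?_, ?_, ?_⟩⟩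
  · rw [φr _ (by linarith)]; simp
  · rw [Δl 0 hσ, H.control_zero]
  · intro a b ha hab hb
    rcases le_total b σ with hbσ | hbσ
    · rw [Δl b hbσ, Δl a (hab.trans hbσ)]; exact H.control a b ha hab hbσ
    rcases le_total a σ with haσ | haσ
    · rw [Δl a haσ, Δr b hbσ]
      -- Convexity of `D` enters here: the scaled sets `(σ - a) • D` and `(b - σ) • D` add up to `(b
      -- - a) • D`.
      have e : b - a = (σ - a) + (b - σ) := by ring
      rw [e, hDc.add_smul (by linarith) (by linarith)]
      have e2 : Δ σ + (b - σ) • d - Δ a = (Δ σ - Δ a) + (b - σ) • d := by abel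
      rw [e2]
      exact add_mem_add (H.control a σ ha haσ le_rfl) (smul_mem_smul_set hd)
    · rw [Δr a haσ, Δr b hbσ]
      have e2 : Δ σ + (b - σ) • d - (Δ σ + (a - σ) • d) = (b - a) • d := by
        rw [add_sub_add_left_eq_sub, ← sub_smul]; congr 1; ring
      rw [e2]
      exact smul_mem_smul_set hd
  · intro a b ha hab hb
    rcases le_total b σ with hbσ | hbσ
    · rw [φl b hbσ, φl a (hab.trans hbσ)]; exact H.speed a b ha hab hbσ
    rcases le_total a σ with haσ | haσ
    · rw [φl a haσ, φr b hbσ]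
      have e2 : φ σ + (b - σ) • G - φ a = (φ σ - φ a) + (b - σ) • G := by abel
      rw [e2]
      linarith [norm_add_le (φ σ - φ a) ((b - σ) • G), H.speed a σ ha haσ le_rfl, speedr b hbσ]
    · rw [φr a haσ, φr b hbσ]
      have e2 : φ σ + (b - σ) • G - (φ σ + (a - σ) • G) = (b - a) • G := by
        rw [add_sub_add_left_eq_sub, ← sub_smul]; congr 1; ring
      rw [e2, norm_smul, Real.norm_eq_abs, abs_of_nonneg (by linarith), mul_comm]
      exact mul_le_mul_of_nonneg_right hGB (by linarith)
  · intro a b ha hab hb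
    rcases le_total b σ with hbσ | hbσ
    · rw [φl b hbσ, φl a (hab.trans hbσ), Δl b hbσ, Δl a (hab.trans hbσ)]
      exact H.defect a b ha hab hbσ
    rcases le_total a σ with haσ | haσ
    · rw [φl a haσ, φr b hbσ, Δl a haσ, Δr b hbσ]
      have e2 : φ σ + (b - σ) • G - φ a
            - ((b - a) • F₁ (φ a) + F₂ (φ a) (Δ σ + (b - σ) • d - Δ a))
          = (φ σ - φ a - ((σ - a) • F₁ (φ a) + F₂ (φ a) (Δ σ - Δ a)))
            + (b - σ) • (G - (F₁ (φ a) + F₂ (φ a) d)) := by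
        simp only [map_add, map_sub, map_smul]; module
      rw [e2]
      have h1 := H.defect a σ ha haσ le_rfl
      have h2 : ‖(b - σ) • (G - (F₁ (φ a) + F₂ (φ a) d))‖
          ≤ (b - σ) * (L * (ε + B * (b - a))) := by
        rw [norm_smul, Real.norm_eq_abs, abs_of_nonneg (by linarith)]
        refine mul_le_mul_of_nonneg_left ((lipG _).trans ?_) (by linarith)
        refine mul_le_mul_of_nonneg_left ?_ hL
        have h3 : ‖x - φ a‖ ≤ ‖x - φ σ‖ + ‖φ σ - φ a‖ := norm_sub_le_norm_sub_add_norm_sub _ _ _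
        have h4 := H.speed a σ ha haσ le_rfl
        rw [norm_sub_rev x (φ σ)] at h3
        nlinarith [mul_nonneg hB h0, mul_le_mul_of_nonneg_left hbσ hB]
      have h5 : (σ - a) * (L * (ε + B * (σ - a))) ≤ (σ - a) * (L * (ε + B * (b - a))) := by
        refine mul_le_mul_of_nonneg_left (mul_le_mul_of_nonneg_left ?_ hL) (by linarith)
        nlinarith
      calc _ ≤ _ := norm_add_le _ _
        _ ≤ (σ - a) * (L * (ε + B * (b - a))) + (b - σ) * (L * (ε + B * (b - a))) := by linarith
        _ = _ := by ring
    · rw [Δr a haσ, Δr b hbσ]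
      have e2 : φ' b - φ' a - ((b - a) • F₁ (φ' a)
            + F₂ (φ' a) (Δ σ + (b - σ) • d - (Δ σ + (a - σ) • d)))
          = (b - a) • (G - (F₁ (φ' a) + F₂ (φ' a) d)) := by
        rw [φr b hbσ]
        nth_rw 1 [φr a haσ]
        simp only [map_add, map_sub, map_smul]; module
      rw [e2, norm_smul, Real.norm_eq_abs, abs_of_nonneg (by linarith)]
      refine mul_le_mul_of_nonneg_left ((lipG _).trans ?_) (by linarith)
      refine mul_le_mul_of_nonneg_left ?_ hL
      have h3 : ‖x - φ' a‖ ≤ ‖x - φ σ‖ + ‖(a - σ) • G‖ := by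
        rw [φr a haσ, ← sub_sub]; exact norm_sub_le _ _
      have h4 := speedr a haσ
      rw [norm_sub_rev x (φ σ)] at h3
      nlinarith [mul_le_mul_of_nonneg_left (show a - σ ≤ h by linarith) hB,
        mul_nonneg hB (sub_nonneg.2 hab)]

/-- The jumps are left out: each Euler step of the pseudo-orbit is copied onto the curve with its
velocity unchanged, so the two drift apart only through jumps, by at most `c` in space and in time.
-/
lemma PseudoOrbit.exists_isApproxTrajectory (hF : IsBoundedLipschitz F₁ F₂ D B L)
    (hDc : Convex ℝ D) (hDn : D.Nonempty) {z : E × ℝ} {c : ℝ}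
    (h : PseudoOrbit F₁ F₂ D X₀ η z c) :
    ∃ σ φ Δ, φ 0 ∈ X₀ ∧ ‖φ σ - z.1‖ ≤ c ∧ |σ - z.2| ≤ c ∧
      IsApproxTrajectory F₁ F₂ D B L (c + B * η) σ φ Δ := by
  have hB := hF.bound_nonneg
  have hL := hF.lip_nonneg
  induction h with
  | start x hx =>
    refine ⟨0, fun _ => x, fun _ => 0, hx, by simp, by simp, ⟨le_rfl, rfl, ?_, ?_, ?_⟩⟩
    · intro a b ha hab hb
      obtain rfl : a = 0 := by linarith
      obtain rfl : b = 0 := by linarith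
      simp [zero_smul_set hDn]
    · intro a b ha hab hb
      simpa using mul_nonneg hB (sub_nonneg.2 hab)
    · intro a b ha hab hb
      obtain rfl : a = 0 := by linarith
      obtain rfl : b = 0 := by linarith
      simp
  | step z c d h hz hd h0 hhη ih =>
    obtain ⟨σ, φ, Δ, h1, h2, h3, H⟩ := ih
    obtain ⟨φ', Δ', e0, e1, H'⟩ := H.extend hF hDc hd h0 h2
      (by nlinarith [mul_le_mul_of_nonneg_left hhη hB])
    refine ⟨σ + h, φ', Δ', e0 ▸ h1, ?_, ?_, H'⟩
    · rw [e1]; simpa using h2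
    · simpa using h3
  | jump z e c hz ih =>
    obtain ⟨σ, φ, Δ, h1, h2, h3, H⟩ := ih
    have he1 : ‖e.1‖ ≤ ‖e‖ := norm_fst_le e
    have he2 : |e.2| ≤ ‖e‖ := norm_snd_le e
    refine ⟨σ, φ, Δ, h1, ?_, ?_, H.mono hF (by linarith [norm_nonneg e])⟩
    · rw [Prod.fst_add, ← sub_sub]
      linarith [norm_sub_le (φ σ - z.1) e.1]
    · rw [Prod.snd_add, ← sub_sub]
      linarith [abs_sub (σ - z.2) e.2]

end PseudoOrbits

/-! ### Lipschitz curves are integrals of their derivatives. -/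

section LipschitzCurves

variable {E : Type*} [NormedAddCommGroup E]

lemma LipschitzWith.of_norm_sub_le_of_le {f : ℝ → E} {C : ℝ}
    (hf : ∀ a b, a ≤ b → ‖f b - f a‖ ≤ C * (b - a)) : LipschitzWith C.toNNReal f := by
  refine LipschitzWith.of_dist_le' fun x y => ?_
  rcases le_total x y with h | h
  · rw [dist_comm, dist_eq_norm, Real.dist_eq, abs_sub_comm, abs_of_nonneg (sub_nonneg.2 h)]
    exact hf x y h
  · rw [dist_eq_norm, Real.dist_eq, abs_of_nonneg (sub_nonneg.2 h)]
    exact hf y x h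

variable [NormedSpace ℝ E] [FiniteDimensional ℝ E]

lemma LipschitzWith.intervalIntegrable_deriv {f : ℝ → E} {C : NNReal} (hf : LipschitzWith C f)
    (a b : ℝ) : IntervalIntegrable (deriv f) volume a b :=
  (intervalIntegrable_const (c := (C : ℝ))).mono_fun
    (stronglyMeasurable_deriv f).aestronglyMeasurable
    (ae_of_all _ fun x => by
      simpa using norm_deriv_le_of_lipschitz hf)

/-- The fundamental theorem of calculus for Lipschitz curves. -/
lemma LipschitzWith.integral_deriv_eq_sub {f : ℝ → E} {C : NNReal} (hf : LipschitzWith C f)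
    (a b : ℝ) : ∫ x in a..b, deriv f x = f b - f a := by
  have : CompleteSpace E := FiniteDimensional.complete ℝ E
  have hi := hf.intervalIntegrable_deriv
  have hlip : LipschitzWith C (fun x => ∫ s in a..x, deriv f s) := by
    refine LipschitzWith.of_dist_le_mul fun x y => ?_
    rw [dist_eq_norm, intervalIntegral.integral_interval_sub_left (hi _ _) (hi _ _), Real.dist_eq]
    exact intervalIntegral.norm_integral_le_of_norm_le_const fun s _ =>
      norm_deriv_le_of_lipschitz hf
  -- The difference of `f` and the primitive of its derivative is absolutely continuous with
  -- derivative zero almost everywhere, hence constant.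
  have hac : AbsolutelyContinuousOnInterval (f - fun x => ∫ s in a..x, deriv f s) a b :=
    (hf.lipschitzOnWith (s := uIcc a b)).absolutelyContinuousOnInterval.sub
      (hlip.lipschitzOnWith (s := uIcc a b)).absolutelyContinuousOnInterval
  have hae : ∀ᵐ x, x ∈ uIcc a b → HasDerivAt (f - fun x => ∫ s in a..x, deriv f s) 0 x := by
    filter_upwards [hf.ae_differentiableAt_real, (hi a b).ae_hasDerivAt_integral] with x h1 h2 h3
    simpa using h1.hasDerivAt.sub (h2 h3 a left_mem_uIcc)
  obtain ⟨c, hc⟩ := hac.const_of_ae_hasDerivAt_zero hae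
  have h1 := hc a left_mem_uIcc
  have h2 := hc b right_mem_uIcc
  simp only [Pi.sub_apply, intervalIntegral.integral_same, sub_zero] at h1 h2
  rw [h1, ← h2]
  abel

end LipschitzCurves

/-- Along one fixed ultrafilter all the limits below exist at once, which replaces diagonal
subsequences and Arzelà–Ascoli. -/
lemma IsCompact.exists_tendsto_ultrafilter {X ι : Type*} [TopologicalSpace X] {K : Set X}
    (hK : IsCompact K) (U : Ultrafilter ι) {u : ι → X} (hu : ∀ i, u i ∈ K) :
    ∃ x ∈ K, Tendsto u U (𝓝 x) :=
  hK.ultrafilter_le_nhds (U.map u)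
    (le_principal_iff.2 (Filter.mem_map.2 (Filter.univ_mem' hu)))

/-! ### Compactness of approximate trajectories and recovery of the disturbance. -/

section Limits

variable {E W : Type*} [NormedAddCommGroup E] [NormedSpace ℝ E]
  [NormedAddCommGroup W] [NormedSpace ℝ W]
  {F₁ : E → E} {F₂ : E → W →L[ℝ] E} {D : Set W} {B L : ℝ}

/-- `F₁` and `F₂` need not be continuous separately. The Lipschitz bound, uniform over `D`, moves
the state to `x'`, and there the field is continuous in `d`. -/
lemma IsBoundedLipschitz.tendsto {ι : Type*} {l : Filter ι} (hF : IsBoundedLipschitz F₁ F₂ D B L)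
    {x : ι → E} {d : ι → W} {x' : E} {d' : W} (hd : ∀ i, d i ∈ D) (hx : Tendsto x l (𝓝 x'))
    (hd' : Tendsto d l (𝓝 d')) :
    Tendsto (fun i => F₁ (x i) + F₂ (x i) (d i)) l (𝓝 (F₁ x' + F₂ x' d')) := by
  have h1 : Tendsto (fun i => F₁ x' + F₂ x' (d i)) l (𝓝 (F₁ x' + F₂ x' d')) :=
    tendsto_const_nhds.add (((F₂ x').continuous.tendsto d').comp hd')
  have h2 : Tendsto (fun i => (F₁ (x i) + F₂ (x i) (d i)) - (F₁ x' + F₂ x' (d i))) l (𝓝 0) := by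
    refine squeeze_zero_norm (fun i => hF.lip (x i) x' (d i) (hd i)) ?_
    have := (tendsto_iff_norm_sub_tendsto_zero.1 hx).const_mul L
    simpa using this
  simpa using h2.add h1

/-- The conditions on an approximate trajectory are closed conditions on increments of `φ` and `Δ`,
so they survive pointwise limits. That is the purpose of carrying the integrated disturbance `Δ`:
the disturbances themselves need not converge pointwise. -/
lemma IsApproxTrajectory.exists_limit [FiniteDimensional ℝ E]
    (hF : IsBoundedLipschitz F₁ F₂ D B L) (hD : IsCompact D)
    {X₀ K : Set E} (hX₀ : IsCompact X₀) (hK : IsCompact K) {T : ℝ}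
    {ε c σ t : ℕ → ℝ} {x : ℕ → E} {φ : ℕ → ℝ → E} {Δ : ℕ → ℝ → W}
    (H : ∀ k, IsApproxTrajectory F₁ F₂ D B L (ε k) (σ k) (φ k) (Δ k))
    (hφ0 : ∀ k, φ k 0 ∈ X₀) (hx : ∀ k, x k ∈ K) (ht : ∀ k, t k ∈ Icc 0 T)
    (hφx : ∀ k, ‖φ k (σ k) - x k‖ ≤ c k) (hσt : ∀ k, |σ k - t k| ≤ c k)
    (hε : Tendsto ε atTop (𝓝 0)) (hc : Tendsto c atTop (𝓝 0)) :
    ∃ σ' ∈ Icc 0 T, ∃ φ' Δ', IsApproxTrajectory F₁ F₂ D B L 0 σ' φ' Δ' ∧ φ' 0 ∈ X₀ ∧ φ' σ' ∈ K := by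
  have hB := hF.bound_nonneg
  have hL := hF.lip_nonneg
  have : ProperSpace E := FiniteDimensional.proper_real E
  let U : Ultrafilter ℕ := hyperfilter ℕ
  have hU : (U : Filter ℕ) ≤ atTop := Nat.hyperfilter_le_atTop
  replace hε := hε.mono_left hU
  replace hc := hc.mono_left hU
  obtain ⟨σ', hσ'T, hσ'⟩ := isCompact_Icc.exists_tendsto_ultrafilter U ht
  obtain ⟨x', hx'K, hx'⟩ := hK.exists_tendsto_ultrafilter U hx
  have hσ : Tendsto σ U (𝓝 σ') := by
    have h0 : Tendsto (fun k => σ k - t k) U (𝓝 0) := squeeze_zero_norm hσt hc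
    simpa using h0.add hσ'
  -- The curves live on intervals `[0, σ k]` of varying length, so times are clamped to them.
  let p : ℕ → ℝ → ℝ := fun k r => min (max r 0) (σ k)
  have p0 : ∀ k r, 0 ≤ p k r := fun k r => le_min (le_max_right _ _) (H k).nonneg
  have pσ : ∀ k r, p k r ≤ σ k := fun k r => min_le_right _ _
  have pmono : ∀ k a b, a ≤ b → p k a ≤ p k b := fun k a b hab => by
    simp only [p]; gcongr
  have pabs : ∀ k r, p k r ≤ |r| := fun k r =>
    (min_le_left _ _).trans (max_le (le_abs_self r) (abs_nonneg r))
  have plim : ∀ r, 0 ≤ r → r ≤ σ' → Tendsto (fun k => p k r) U (𝓝 r) := by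
    intro r h0 h1
    have := (tendsto_const_nhds (x := max r 0)).min hσ
    simpa only [p, max_eq_left h0, min_eq_left h1] using this
  obtain ⟨R, hR⟩ := hX₀.isBounded.exists_norm_le
  have hφb : ∀ r, ∃ y, Tendsto (fun k => φ k (p k r)) U (𝓝 y) := by
    intro r
    obtain ⟨y, -, hy⟩ := (isCompact_closedBall (0 : E) (R + B * |r|)).exists_tendsto_ultrafilter U
      (u := fun k => φ k (p k r)) (fun k => by
        rw [mem_closedBall_zero_iff]
        have h1 := (H k).speed 0 (p k r) le_rfl (p0 k r) (pσ k r)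
        have h2 := hR _ (hφ0 k)
        have h3 : ‖φ k (p k r)‖ ≤ ‖φ k 0‖ + ‖φ k (p k r) - φ k 0‖ := norm_le_norm_add_norm_sub' _ _
        have h4 := mul_le_mul_of_nonneg_left (pabs k r) hB
        linarith)
    exact ⟨y, hy⟩
  have hdex : ∀ a b, a ≤ b → ∀ k, ∃ d ∈ D, (p k b - p k a) • d = Δ k (p k b) - Δ k (p k a) :=
    fun a b hab k => mem_smul_set.1 ((H k).control _ _ (p0 k a) (pmono k a b hab) (pσ k b))
  have hΔb : ∀ r, ∃ w, Tendsto (fun k => Δ k (p k r)) U (𝓝 w) := by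
    intro r
    have : ∀ k, ∃ d ∈ D, p k r • d = Δ k (p k r) := fun k => by
      simpa [(H k).control_zero] using
        mem_smul_set.1 ((H k).control 0 _ le_rfl (p0 k r) (pσ k r))
    choose d hd hdΔ using this
    obtain ⟨d', -, hd'⟩ := hD.exists_tendsto_ultrafilter U hd
    obtain ⟨q, -, hq⟩ := (isCompact_Icc (a := 0) (b := |r|)).exists_tendsto_ultrafilter U
      (u := fun k => p k r) (fun k => ⟨p0 k r, pabs k r⟩)
    exact ⟨q • d', by simpa only [hdΔ] using hq.smul hd'⟩
  choose φ' hφ' using hφb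
  choose Δ' hΔ' using hΔb
  have pz : ∀ k, p k 0 = 0 := fun k => by simp [p, (H k).nonneg]
  refine ⟨σ', hσ'T, φ', Δ', ⟨hσ'T.1, ?_, ?_, ?_, ?_⟩, ?_, ?_⟩
  · refine tendsto_nhds_unique (hΔ' 0) ?_
    simp only [pz, (H _).control_zero, tendsto_const_nhds]
  · intro a b ha hab hb
    choose d hd hdΔ using hdex a b hab
    obtain ⟨d', hd'D, hd'⟩ := hD.exists_tendsto_ultrafilter U hd
    have h1 := ((plim b (ha.trans hab) hb).sub (plim a ha (hab.trans hb))).smul hd'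
    simp only [hdΔ] at h1
    rw [tendsto_nhds_unique ((hΔ' b).sub (hΔ' a)) h1]
    exact smul_mem_smul_set hd'D
  · intro a b ha hab hb
    exact le_of_tendsto_of_tendsto' ((hφ' b).sub (hφ' a)).norm
      (((plim b (ha.trans hab) hb).sub (plim a ha (hab.trans hb))).const_mul B)
      fun k => (H k).speed _ _ (p0 k a) (pmono k a b hab) (pσ k b)
  · intro a b ha hab hb
    choose d hd hdΔ using hdex a b hab
    obtain ⟨d', hd'D, hd'⟩ := hD.exists_tendsto_ultrafilter U hd
    have hba := (plim b (ha.trans hab) hb).sub (plim a ha (hab.trans hb))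
    have h1 := hba.smul hd'
    simp only [hdΔ] at h1
    have e1 : Δ' b - Δ' a = (b - a) • d' := tendsto_nhds_unique ((hΔ' b).sub (hΔ' a)) h1
    have h2 := hba.smul (hF.tendsto hd (hφ' a) hd')
    rw [e1, map_smul, ← smul_add]
    refine le_of_tendsto_of_tendsto' (((hφ' b).sub (hφ' a)).sub h2).norm
      (hba.mul ((hε.add (hba.const_mul B)).const_mul L)) fun k => ?_
    rw [smul_add, ← map_smul, hdΔ]
    exact (H k).defect _ _ (p0 k a) (pmono k a b hab) (pσ k b)
  · refine hX₀.isClosed.mem_of_tendsto (hφ' 0) (Eventually.of_forall fun k => ?_)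
    rw [pz]; exact hφ0 k
  -- The limit curve at `σ'` is the limit of the clamped values; the speed bound identifies this
  -- with the limit of the true endpoints.
  · have h1 : Tendsto (fun k => φ k (σ k) - φ k (p k σ')) U (𝓝 0) := by
      refine squeeze_zero_norm (fun k => (H k).speed _ _ (p0 k σ') (pσ k σ') le_rfl) ?_
      simpa using (hσ.sub (plim σ' hσ'T.1 le_rfl)).const_mul B
    have h2 : Tendsto (fun k => φ k (σ k) - x k) U (𝓝 0) := squeeze_zero_norm hφx hc
    have h3 := (h2.sub h1).add hx'
    have e : (fun k => φ k (σ k) - x k - (φ k (σ k) - φ k (p k σ')) + x k)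
        = fun k => φ k (p k σ') := by funext k; abel
    rw [e] at h3
    rw [tendsto_nhds_unique (hφ' σ') h3]
    simpa using hx'K

/-- An approximate trajectory without error is a trajectory for a measurable control. -/
lemma IsApproxTrajectory.exists_control [FiniteDimensional ℝ E] [FiniteDimensional ℝ W]
    [MeasurableSpace W] [BorelSpace W]
    (hF : IsBoundedLipschitz F₁ F₂ D B L) (hD : IsCompact D) (hDn : D.Nonempty)
    {σ : ℝ} {φ : ℝ → E} {Δ : ℝ → W} (H : IsApproxTrajectory F₁ F₂ D B L 0 σ φ Δ) :
    ∃ d : ℝ → W, Measurable d ∧ (∀ t, d t ∈ D) ∧ ∀ t ∈ Icc 0 σ,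
      IntervalIntegrable (fun s => F₁ (φ s) + F₂ (φ s) (d s)) volume 0 t ∧
      φ t = φ 0 + ∫ s in (0 : ℝ)..t, (F₁ (φ s) + F₂ (φ s) (d s)) := by
  have hB := hF.bound_nonneg
  have hL := hF.lip_nonneg
  obtain ⟨d₀, hd₀⟩ := hDn
  obtain ⟨C, hC⟩ := hD.isBounded.exists_norm_le
  have hC0 : 0 ≤ C := (norm_nonneg _).trans (hC d₀ hd₀)
  let p : ℝ → ℝ := fun r => min (max r 0) σ
  have p0 : ∀ r, 0 ≤ p r := fun r => le_min (le_max_right _ _) H.nonneg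
  have pσ : ∀ r, p r ≤ σ := fun r => min_le_right _ _
  have pmono : ∀ a b, a ≤ b → p a ≤ p b := fun a b hab => by
    simp only [p]; gcongr
  have pid : ∀ r, 0 ≤ r → r ≤ σ → p r = r := fun r h0 h1 => by
    simp only [p]; rw [max_eq_left h0, min_eq_left h1]
  have plip : ∀ a b, a ≤ b → p b - p a ≤ b - a := fun a b hab => by
    simp only [p]; grind
  let φ' : ℝ → E := fun r => φ (p r)
  let Δ' : ℝ → W := fun r => Δ (p r)
  have hφ' : LipschitzWith B.toNNReal φ' := LipschitzWith.of_norm_sub_le_of_le fun a b hab =>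
    (H.speed _ _ (p0 a) (pmono a b hab) (pσ b)).trans
      (mul_le_mul_of_nonneg_left (plip a b hab) hB)
  have hΔ' : LipschitzWith C.toNNReal Δ' := LipschitzWith.of_norm_sub_le_of_le fun a b hab => by
    obtain ⟨d, hd, e⟩ := mem_smul_set.1 (H.control _ _ (p0 a) (pmono a b hab) (pσ b))
    rw [← e, norm_smul, Real.norm_eq_abs, abs_of_nonneg (sub_nonneg.2 (pmono a b hab)), mul_comm]
    exact mul_le_mul (hC d hd) (plip a b hab) (sub_nonneg.2 (pmono a b hab)) hC0
  classical
  -- The disturbance is the derivative of `Δ'`; the default `d₀` makes it take values in `D`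
  -- everywhere while staying measurable.
  let d : ℝ → W := fun t => if deriv Δ' t ∈ D then deriv Δ' t else d₀
  have hdm : Measurable d := by
    have := FiniteDimensional.complete ℝ W
    exact Measurable.ite (measurable_deriv Δ' hD.isClosed.measurableSet) (measurable_deriv Δ')
      measurable_const
  have key : ∀ t, 0 < t → t < σ → DifferentiableAt ℝ φ' t → DifferentiableAt ℝ Δ' t →
      deriv φ' t = F₁ (φ t) + F₂ (φ t) (d t) := by
    -- Difference quotients of `Δ'` lie in the closed set `D`, so their limit does too. With `ε = 0`
    -- the defect is quadratic in `b - t`, so dividing by `b - t` yields the differential equation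
    -- as `b` decreases to `t`.
    intro t h0 h1 h2 h3
    have hev : ∀ᶠ b in 𝓝[>] t, b ∈ Ioo t σ := Ioo_mem_nhdsGT h1
    have sφ : Tendsto (slope φ' t) (𝓝[>] t) (𝓝 (deriv φ' t)) :=
      (hasDerivAt_iff_tendsto_slope.1 h2.hasDerivAt).mono_left (nhdsGT_le_nhdsNE t)
    have sΔ : Tendsto (slope Δ' t) (𝓝[>] t) (𝓝 (deriv Δ' t)) :=
      (hasDerivAt_iff_tendsto_slope.1 h3.hasDerivAt).mono_left (nhdsGT_le_nhdsNE t)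
    have pt : p t = t := pid t h0.le h1.le
    have hdD : deriv Δ' t ∈ D := by
      refine hD.isClosed.mem_of_tendsto sΔ (hev.mono fun b hb => ?_)
      obtain ⟨e, he, e1⟩ := mem_smul_set.1 (H.control t b h0.le hb.1.le hb.2.le)
      have : slope Δ' t b = e := by
        simp only [slope_def_module, Δ', pt, pid b (h0.trans hb.1).le hb.2.le]
        rw [← e1, smul_smul, inv_mul_cancel₀ (sub_ne_zero.2 hb.1.ne'), one_smul]
      rwa [this]
    have hdt : d t = deriv Δ' t := if_pos hdD
    rw [hdt]
    have l1 : Tendsto (fun b => slope φ' t b - (F₁ (φ t) + F₂ (φ t) (slope Δ' t b))) (𝓝[>] t)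
        (𝓝 (deriv φ' t - (F₁ (φ t) + F₂ (φ t) (deriv Δ' t)))) :=
      sφ.sub (tendsto_const_nhds.add (((F₂ (φ t)).continuous.tendsto _).comp sΔ))
    have l2 : Tendsto (fun b => slope φ' t b - (F₁ (φ t) + F₂ (φ t) (slope Δ' t b))) (𝓝[>] t)
        (𝓝 0) := by
      have l3 : Tendsto (fun b => L * (B * (b - t))) (𝓝[>] t) (𝓝 0) := by
        have : Tendsto (fun b => L * (B * (b - t))) (𝓝 t) (𝓝 (L * (B * (t - t)))) :=
          (by fun_prop : Continuous fun b => L * (B * (b - t))).tendsto t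
        simp only [sub_self, mul_zero] at this
        exact this.mono_left nhdsWithin_le_nhds
      refine squeeze_zero_norm' (hev.mono fun b hb => ?_) l3
      have hbt : 0 < b - t := sub_pos.2 hb.1
      have h4 := H.defect t b h0.le hb.1.le hb.2.le
      have e : slope φ' t b - (F₁ (φ t) + F₂ (φ t) (slope Δ' t b))
          = (b - t)⁻¹ • (φ b - φ t - ((b - t) • F₁ (φ t) + F₂ (φ t) (Δ b - Δ t))) := by
        simp only [slope_def_module, φ', Δ', pt, pid b (h0.trans hb.1).le hb.2.le, map_smul]
        rw [smul_sub _ (φ b - φ t), smul_add, smul_smul, inv_mul_cancel₀ hbt.ne', one_smul,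
          smul_sub]
      rw [e, norm_smul, norm_inv, Real.norm_eq_abs, abs_of_pos hbt, inv_mul_le_iff₀ hbt]
      simpa using h4
    exact sub_eq_zero.1 (tendsto_nhds_unique l1 l2)
  refine ⟨d, hdm, fun t => ?_, fun t ht => ?_⟩
  · simp only [d]; split_ifs with h
    exacts [h, hd₀]
  · have hae : ∀ᵐ s, s ∈ uIoc 0 t → deriv φ' s = F₁ (φ s) + F₂ (φ s) (d s) := by
      have hne : ∀ᵐ s : ℝ, s ≠ t := by simp [ae_iff, measure_singleton]
      filter_upwards [hφ'.ae_differentiableAt_real, hΔ'.ae_differentiableAt_real, hne]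
        with s h1 h2 h3 h4
      rw [uIoc_of_le ht.1] at h4
      exact key s h4.1 ((lt_of_le_of_ne h4.2 h3).trans_le ht.2) h1 h2
    refine ⟨(hφ'.intervalIntegrable_deriv 0 t).congr_ae
      ((ae_restrict_iff' measurableSet_uIoc).2 hae), ?_⟩
    rw [← intervalIntegral.integral_congr_ae hae, hφ'.integral_deriv_eq_sub]
    simp only [φ', pid t ht.1 ht.2, pid 0 le_rfl H.nonneg]
    abel

end Limits

/-! ### The jump cost and its mollification. -/

section ValueFunction

variable {E W : Type*} [NormedAddCommGroup E] [NormedSpace ℝ E]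
  [NormedAddCommGroup W] [NormedSpace ℝ W]
  {F₁ : E → E} {F₂ : E → W →L[ℝ] E} {D : Set W} {B L η : ℝ} {X₀ : Set E}

/-- The least total size of the jumps needed to reach a point of space-time from `X₀ × {0}`. -/
noncomputable def jumpCost (F₁ : E → E) (F₂ : E → W →L[ℝ] E) (D : Set W) (X₀ : Set E) (η : ℝ)
    (z : E × ℝ) : ℝ :=
  sInf {c | PseudoOrbit F₁ F₂ D X₀ η z c}

lemma jumpCost_le {z : E × ℝ} {c : ℝ} (h : PseudoOrbit F₁ F₂ D X₀ η z c) :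
    jumpCost F₁ F₂ D X₀ η z ≤ c :=
  csInf_le ⟨0, fun _ h => h.cost_nonneg⟩ h

/-- A single jump reaches any point, so the infimum is never over the empty set. -/
lemma exists_pseudoOrbit (hX₀ : X₀.Nonempty) (z : E × ℝ) :
    {c | PseudoOrbit F₁ F₂ D X₀ η z c}.Nonempty := by
  obtain ⟨x, hx⟩ := hX₀
  have := PseudoOrbit.jump (F₁ := F₁) (F₂ := F₂) (D := D) (η := η) _ (z - (x, 0)) _
    (PseudoOrbit.start x hx)
  rw [add_sub_cancel] at this
  exact ⟨_, this⟩

lemma le_jumpCost (hX₀ : X₀.Nonempty) {z : E × ℝ} {δ : ℝ}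
    (h : ∀ c, PseudoOrbit F₁ F₂ D X₀ η z c → δ ≤ c) : δ ≤ jumpCost F₁ F₂ D X₀ η z :=
  le_csInf (exists_pseudoOrbit hX₀ z) h

lemma jumpCost_add_le (hX₀ : X₀.Nonempty) (z e : E × ℝ) :
    jumpCost F₁ F₂ D X₀ η (z + e) ≤ jumpCost F₁ F₂ D X₀ η z + ‖e‖ := by
  rw [← sub_le_iff_le_add]
  exact le_jumpCost hX₀ fun c hc => sub_le_iff_le_add.2 (jumpCost_le (hc.jump _ e _))

lemma lipschitzWith_jumpCost (hX₀ : X₀.Nonempty) : LipschitzWith 1 (jumpCost F₁ F₂ D X₀ η) := by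
  refine LipschitzWith.of_le_add fun z w => ?_
  have := jumpCost_add_le (F₁ := F₁) (F₂ := F₂) (D := D) (η := η) hX₀ w (z - w)
  rwa [add_sub_cancel, ← dist_eq_norm] at this

lemma jumpCost_step_le (hX₀ : X₀.Nonempty) (z : E × ℝ) {d : W} (hd : d ∈ D) {h : ℝ} (h0 : 0 ≤ h)
    (hη : h ≤ η) : jumpCost F₁ F₂ D X₀ η (z + h • (F₁ z.1 + F₂ z.1 d, (1 : ℝ)))
      ≤ jumpCost F₁ F₂ D X₀ η z :=
  le_jumpCost hX₀ fun _ hc => jumpCost_le (hc.step _ _ _ _ hd h0 hη)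

lemma jumpCost_initial_nonpos {x : E} (hx : x ∈ X₀) : jumpCost F₁ F₂ D X₀ η (x, 0) ≤ 0 :=
  jumpCost_le (PseudoOrbit.start x hx)

open scoped Convolution in
open ContinuousLinearMap in
/-- Mollification of a Lipschitz function that does not increase along short Euler steps. -/
lemma exists_contDiff_approx_of_step [FiniteDimensional ℝ E]
    (hF : IsBoundedLipschitz F₁ F₂ D B L) {V : E × ℝ → ℝ} (hV : LipschitzWith 1 V) (hη : 0 < η)
    (hstep : ∀ z, ∀ d ∈ D, ∀ h, 0 ≤ h → h ≤ η → V (z + h • (F₁ z.1 + F₂ z.1 d, (1 : ℝ))) ≤ V z)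
    {ε : ℝ} (hε : 0 < ε) :
    ∃ v : E × ℝ → ℝ, ContDiff ℝ 1 v ∧ (∀ z, |v z - V z| ≤ ε) ∧
      ∀ z, ∀ d ∈ D, fderiv ℝ v z (F₁ z.1 + F₂ z.1 d, 1) ≤ L * ε := by
  borelize (E × ℝ)
  let μ : Measure (E × ℝ) := Measure.addHaar
  let ρ : ContDiffBump (0 : E × ℝ) := ⟨ε / 2, ε, half_pos hε, half_lt_self hε⟩
  have hvs : ContDiff ℝ 1 (ρ.normed μ ⋆[lsmul ℝ ℝ, μ] V) :=
    ρ.hasCompactSupport_normed.contDiff_convolution_left (n := 1) _ ρ.contDiff_normed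
      hV.continuous.locallyIntegrable
  have hint : ∀ z, Integrable (fun y => ρ.normed μ y * V (z - y)) μ := fun z =>
    (ρ.continuous_normed.mul (hV.continuous.comp (by fun_prop))).integrable_of_hasCompactSupport
      ρ.hasCompactSupport_normed.mul_right
  refine ⟨_, hvs, fun z => ?_, fun z d hd => ?_⟩
  · refine ρ.dist_normed_convolution_le hV.continuous.aestronglyMeasurable fun x hx => ?_
    have := hV.dist_le_mul x z
    rw [NNReal.coe_one, one_mul] at this
    exact this.trans (Metric.mem_ball.1 hx).le
  · set v := ρ.normed μ ⋆[lsmul ℝ ℝ, μ] V with hv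
    have hvz : ∀ z, v z = ∫ y, ρ.normed μ y * V (z - y) ∂μ := fun z => by
      simp [hv, convolution_def]
    set ξ : E × ℝ := (F₁ z.1 + F₂ z.1 d, 1) with hξ
    have hdiff : ∀ h, 0 ≤ h → h ≤ η → v (z + h • ξ) - v z ≤ h * (L * ε) := by
      intro h h0 h1
      have hρ : ∫ y, ρ.normed μ y * (h * (L * ε)) ∂μ = h * (L * ε) := by
        rw [integral_mul_const, ρ.integral_normed, one_mul]
      rw [hvz, hvz, ← integral_sub (hint _) (hint _), ← hρ]
      refine integral_mono ((hint _).sub (hint _)) (ρ.integrable_normed.mul_const _) fun y => ?_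
      change ρ.normed μ y * V (z + h • ξ - y) - ρ.normed μ y * V (z - y)
        ≤ ρ.normed μ y * (h * (L * ε))
      rw [← mul_sub]
      by_cases hy : y ∈ Function.support (ρ.normed μ)
      · refine mul_le_mul_of_nonneg_left ?_ (ρ.nonneg_normed y)
        rw [ρ.support_normed_eq, mem_ball_zero_iff] at hy
        -- The step inequality holds at `z - y` with the velocity `ξ'` found there. Replacing `ξ'`
        -- by `ξ` costs at most `h * ‖ξ - ξ'‖ ≤ h * (L * ε)`, since `V` is 1-Lipschitz and the
        -- kernel is supported in the ball of radius `ε`.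
        set ξ' : E × ℝ := (F₁ (z - y).1 + F₂ (z - y).1 d, 1) with hξ'
        have h2 := hstep (z - y) d hd h h0 h1
        have h3 := hV.dist_le_mul (z + h • ξ - y) (z - y + h • ξ')
        rw [NNReal.coe_one, one_mul, dist_eq_norm, dist_eq_norm] at h3
        have e : z + h • ξ - y - (z - y + h • ξ') = h • (ξ - ξ') := by
          rw [smul_sub]; abel
        have h4 : ‖ξ - ξ'‖ ≤ L * ε := by
          rw [hξ, hξ', Prod.mk_sub_mk, sub_self, Prod.norm_mk, norm_zero,
            max_eq_left (norm_nonneg _)]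
          refine (hF.lip _ _ d hd).trans (mul_le_mul_of_nonneg_left ?_ hF.lip_nonneg)
          rw [Prod.fst_sub, sub_sub_cancel]
          exact (norm_fst_le y).trans hy.le
        rw [e, norm_smul, Real.norm_eq_abs, Real.norm_eq_abs, abs_of_nonneg h0] at h3
        have h5 := mul_le_mul_of_nonneg_left h4 h0
        have h6 := le_abs_self (V (z + h • ξ - y) - V (z - y + h • ξ'))
        linarith
      · rw [Function.notMem_support.1 hy, zero_mul, zero_mul]
    have hd1 : HasDerivAt (fun h : ℝ => v (z + h • ξ)) (fderiv ℝ v z ξ) 0 := by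
      have hv1 : HasFDerivAt v (fderiv ℝ v z) (z + (0 : ℝ) • ξ) := by
        simpa using (hvs.differentiable (by norm_num) z).hasFDerivAt
      have hl : HasDerivAt (fun h : ℝ => z + h • ξ) ξ 0 := by
        simpa using ((hasDerivAt_id (0 : ℝ)).smul_const ξ).const_add z
      exact hv1.comp_hasDerivAt (0 : ℝ) hl
    refine le_of_tendsto ((hasDerivAt_iff_tendsto_slope.1 hd1).mono_left (nhdsGT_le_nhdsNE 0)) ?_
    filter_upwards [Ioo_mem_nhdsGT hη] with h hh
    rw [slope_def_field, sub_zero, zero_smul, add_zero, div_le_iff₀ hh.1, mul_comm]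
    exact hdiff h hh.1.le hh.2.le

end ValueFunction

/-- Subtracting `L * ε * t` absorbs the growth of the mollified cost along the field, and `δ / 2`
places the zero level between the initial values and the boundary values. -/
lemma exists_isBarrierCertificate {n m : ℕ}
    {f : EuclideanSpace ℝ (Fin n) → EuclideanSpace ℝ (Fin m) → EuclideanSpace ℝ (Fin n)}
    {D : Set (EuclideanSpace ℝ (Fin m))} {X₀ S : Set (EuclideanSpace ℝ (Fin n))} {T : ℝ}
    (hT : 0 < T)
    {F₁ : EuclideanSpace ℝ (Fin n) → EuclideanSpace ℝ (Fin n)}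
    {F₂ : EuclideanSpace ℝ (Fin n) → (EuclideanSpace ℝ (Fin m) →L[ℝ] EuclideanSpace ℝ (Fin n))}
    {B L η δ : ℝ} (hF : IsBoundedLipschitz F₁ F₂ D B L)
    (hFf : ∀ x ∈ closure S, ∀ d ∈ D, f x d = F₁ x + F₂ x d) (hX₀ : X₀.Nonempty) (hη : 0 < η)
    (hδ : 0 < δ)
    (hmargin : ∀ x ∈ frontier S, ∀ t ∈ Icc 0 T, ∀ c,
      PseudoOrbit F₁ F₂ D X₀ η (x, t) c → δ ≤ c) :
    ∃ v, IsBarrierCertificate f D X₀ S T v := by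
  have hL := hF.lip_nonneg
  -- This makes the total loss `ε + L * ε * T` equal to `δ / 4`, below the `δ / 2` available on
  -- either side.
  set ε := δ / (4 * (1 + L * T)) with hε_def
  have hLT : 0 ≤ L * T := mul_nonneg hL hT.le
  have hε : 0 < ε := by positivity
  have hεδ : ε * (1 + L * T) = δ / 4 := by rw [hε_def]; field_simp
  obtain ⟨v, hv, hvV, hvd⟩ := exists_contDiff_approx_of_step hF
    (lipschitzWith_jumpCost hX₀) hη (fun z d hd h h0 h1 => jumpCost_step_le hX₀ z hd h0 h1) hε
  have hdiff : Differentiable ℝ v := hv.differentiable (by norm_num)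
  refine ⟨fun x t => v (x, t) - L * ε * t - δ / 2, ?_, ?_, ?_, ?_⟩
  · exact ContDiff.contDiffOn (by fun_prop)
  · intro x hx
    have h1 := (abs_le.1 (hvV (x, 0))).2
    have h2 := jumpCost_initial_nonpos (F₁ := F₁) (F₂ := F₂) (D := D) (η := η) hx
    nlinarith
  · intro x hx t ht
    have h1 := (abs_le.1 (hvV (x, t))).1
    have h2 := le_jumpCost hX₀ (hmargin x hx t ht)
    have h3 := mul_le_mul_of_nonneg_left ht.2 (mul_nonneg hL hε.le)
    nlinarith
  · intro x hx d hd t ht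
    have h1 : HasDerivAt (fun s => v (x, s) - L * ε * s - δ / 2)
        (fderiv ℝ v (x, t) (0, 1) - L * ε) t := by
      have h2 : HasDerivAt (fun s : ℝ => (x, s)) ((0 : EuclideanSpace ℝ (Fin n)), (1 : ℝ)) t :=
        (hasDerivAt_const t x).prodMk (hasDerivAt_id t)
      have h3 := (hdiff (x, t)).hasFDerivAt.comp_hasDerivAt t h2
      simpa using (h3.sub ((hasDerivAt_id t).const_mul (L * ε))).sub_const (δ / 2)
    have h4 : HasFDerivAt (fun y => v (y, t) - L * ε * t - δ / 2)
        ((fderiv ℝ v (x, t)).comp (ContinuousLinearMap.inl ℝ _ ℝ)) x :=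
      (((hdiff (x, t)).hasFDerivAt.comp x (hasFDerivAt_prodMk_left x t)).sub_const _).sub_const _
    rw [h1.hasDerivWithinAt.derivWithin (uniqueDiffOn_Icc hT t ht), h4.fderiv, hFf x hx d hd]
    have h5 := hvd (x, t) d hd
    have h6 : ((F₁ x + F₂ x d, 1) : EuclideanSpace ℝ (Fin n) × ℝ)
        = (0, 1) + (F₁ x + F₂ x d, 0) := by simp
    dsimp only at h5
    rw [h6, map_add] at h5
    simp only [ContinuousLinearMap.comp_apply, ContinuousLinearMap.inl_apply]
    linarith

/-! ### Solutions, maximal extension and first exit. -/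

section Solutions

variable {n m : ℕ}
  {f : EuclideanSpace ℝ (Fin n) → EuclideanSpace ℝ (Fin m) → EuclideanSpace ℝ (Fin n)}
  {d : ℝ → EuclideanSpace ℝ (Fin m)} {x₀ : EuclideanSpace ℝ (Fin n)} {τ : EReal}
  {φ : ℝ → EuclideanSpace ℝ (Fin n)}

/-- Being a solution is tested on each `[0, t]` separately; this is what lets a chain of extensions
be glued. -/
lemma IsSolution.of_forall_exists (hτ : 0 < τ)
    (h : ∀ t : ℝ, 0 ≤ t → (t : EReal) < τ → ∃ (τ' : EReal) (φ' : ℝ → EuclideanSpace ℝ (Fin n)),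
      IsSolution f d x₀ τ' φ' ∧ (t : EReal) < τ' ∧ ∀ s ∈ Icc 0 t, φ s = φ' s) :
    IsSolution f d x₀ τ φ := by
  refine ⟨hτ, fun t h0 h1 => ?_, fun t h0 h1 => ?_⟩
  · obtain ⟨τ', φ', hs, ht, e⟩ := h t h0 h1
    refine (hs.integrable t h0 ht).congr fun s hs => ?_
    rw [uIoc_of_le h0] at hs
    simp only [e s ⟨hs.1.le, hs.2⟩]
  · obtain ⟨τ', φ', hs, ht, e⟩ := h t h0 h1
    rw [e t ⟨h0, le_rfl⟩, hs.eq_integral t h0 ht]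
    congr 1
    refine intervalIntegral.integral_congr fun s hs => ?_
    rw [uIcc_of_le h0] at hs
    simp only [e s hs]

lemma IsSolution.apply_zero (h : IsSolution f d x₀ τ φ) : φ 0 = x₀ := by
  simpa using h.eq_integral 0 le_rfl (by simpa using h.pos)

lemma IsSolution.continuousOn (h : IsSolution f d x₀ τ φ) {t : ℝ} (h0 : 0 ≤ t)
    (ht : (t : EReal) < τ) : ContinuousOn φ (Icc 0 t) := by
  have h1 : ContinuousOn (fun s => x₀ + ∫ r in (0 : ℝ)..s, f (φ r) (d r)) (Icc 0 t) := by
    have := intervalIntegral.continuousOn_primitive_interval' (h.integrable t h0 ht)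
      left_mem_uIcc
    rw [uIcc_of_le h0] at this
    exact continuousOn_const.add this
  refine h1.congr fun s hs => h.eq_integral s hs.1 (lt_of_le_of_lt ?_ ht)
  exact_mod_cast hs.2

/-- Every solution extends to a trajectory on a maximal interval of existence. -/
lemma IsSolution.exists_isTrajectory (h : IsSolution f d x₀ τ φ) :
    ∃ (τ' : EReal) (φ' : ℝ → EuclideanSpace ℝ (Fin n)), IsTrajectory f d x₀ τ' φ' ∧ τ ≤ τ' ∧
      ∀ t : ℝ, 0 ≤ t → (t : EReal) < τ → φ' t = φ t := by
  classical
  -- Extension is only a preorder, as values outside `[0, τ)` are arbitrary; Zorn's lemma is used in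
  -- the form that requires transitivity alone.
  let r : EReal × (ℝ → EuclideanSpace ℝ (Fin n)) → EReal × (ℝ → EuclideanSpace ℝ (Fin n)) → Prop :=
    fun p q => p.1 ≤ q.1 ∧ ∀ t : ℝ, 0 ≤ t → (t : EReal) < p.1 → q.2 t = p.2 t
  have rtrans : ∀ {p q s}, r p q → r q s → r p s := fun hpq hqs =>
    ⟨hpq.1.trans hqs.1, fun t h0 ht =>
      (hqs.2 t h0 (ht.trans_le hpq.1)).trans (hpq.2 t h0 ht)⟩
  have rrefl : ∀ p, r p p := fun p => ⟨le_rfl, fun _ _ _ => rfl⟩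
  let α := {p : EReal × (ℝ → EuclideanSpace ℝ (Fin n)) // IsSolution f d x₀ p.1 p.2 ∧ r (τ, φ) p}
  have : Nonempty α := ⟨⟨(τ, φ), h, rrefl _⟩⟩
  obtain ⟨⟨p, hps, hpr⟩, hmax⟩ := exists_maximal_of_nonempty_chains_bounded
    (r := fun a b : α => r a.1 b.1) (fun c hc ⟨a₀, ha₀⟩ => by
      let σ : EReal := sSup ((fun a : α => a.1.1) '' c)
      -- Any member of the chain defined at `t` supplies the value; comparability makes the choice
      -- immaterial.
      let ψ : ℝ → EuclideanSpace ℝ (Fin n) := fun t =>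
        if ht : ∃ a ∈ c, (t : EReal) < a.1.1 then ht.choose.1.2 t else 0
      have hψ : ∀ a ∈ c, ∀ t : ℝ, 0 ≤ t → (t : EReal) < a.1.1 → ψ t = a.1.2 t := by
        intro a ha t h0 hta
        have ht : ∃ a ∈ c, (t : EReal) < a.1.1 := ⟨a, ha, hta⟩
        have e : ψ t = ht.choose.1.2 t := dif_pos ht
        rw [e]
        obtain ⟨hb, htb⟩ := ht.choose_spec
        rcases eq_or_ne ht.choose a with hab | hab
        · rw [hab]
        · rcases hc hb ha hab with h1 | h1
          · exact (h1.2 t h0 htb).symm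
          · exact h1.2 t h0 hta
      have hσ : ∀ a ∈ c, a.1.1 ≤ σ := fun a ha => le_sSup (mem_image_of_mem _ ha)
      have hr : ∀ a ∈ c, r a.1 (σ, ψ) := fun a ha => ⟨hσ a ha, hψ a ha⟩
      refine ⟨⟨(σ, ψ), IsSolution.of_forall_exists (a₀.2.1.pos.trans_le (hσ a₀ ha₀)) ?_,
        rtrans a₀.2.2 (hr a₀ ha₀)⟩, hr⟩
      intro t h0 ht
      obtain ⟨_, ⟨a, ha, rfl⟩, hta⟩ := lt_sSup_iff.1 ht
      refine ⟨_, _, a.2.1, hta, fun s hs => hψ a ha s hs.1 (lt_of_le_of_lt ?_ hta)⟩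
      exact_mod_cast hs.2)
    (fun h1 h2 => rtrans h1 h2)
  refine ⟨p.1, p.2, ⟨hps, fun τ' φ' hs' he => ?_⟩, hpr.1, hpr.2⟩
  by_contra! hlt
  have hr : r p (τ', φ') := ⟨hlt.le, he⟩
  exact hlt.not_ge (hmax ⟨(τ', φ'), hs', rtrans hpr hr⟩ hr).1

end Solutions

/-- A curve that leaves an open set meets its boundary when it does so for the first time. -/
lemma exists_first_exit {X : Type*} [TopologicalSpace X] {S : Set X} (hS : IsOpen S) {φ : ℝ → X}
    {σ : ℝ} (hσ : 0 ≤ σ) (hφ : ContinuousOn φ (Icc 0 σ)) (h0 : φ 0 ∈ S) (h1 : φ σ ∉ S) :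
    ∃ s, 0 < s ∧ s ≤ σ ∧ φ s ∈ frontier S ∧ ∀ t, 0 ≤ t → t < s → φ t ∈ S := by
  have hclosed : IsClosed (Icc 0 σ ∩ φ ⁻¹' Sᶜ) :=
    hφ.preimage_isClosed_of_isClosed isClosed_Icc hS.isClosed_compl
  have hcomp : IsCompact (Icc 0 σ ∩ φ ⁻¹' Sᶜ) :=
    isCompact_Icc.of_isClosed_subset hclosed inter_subset_left
  obtain ⟨s, ⟨hs, hsS⟩, hmin⟩ := hcomp.exists_isLeast ⟨σ, ⟨hσ, le_rfl⟩, h1⟩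
  have hs0 : 0 < s := hs.1.lt_of_ne (by rintro rfl; exact hsS h0)
  have hlt : ∀ t, 0 ≤ t → t < s → φ t ∈ S := fun t ht hts => by
    by_contra h
    exact hts.not_ge (hmin ⟨⟨ht, hts.le.trans hs.2⟩, h⟩)
  refine ⟨s, hs0, hs.2, ?_, hlt⟩
  rw [hS.frontier_eq]
  refine ⟨?_, hsS⟩
  have hcs : ContinuousWithinAt φ (Ico 0 s) s :=
    (hφ s hs).mono fun t ht => ⟨ht.1, ht.2.le.trans hs.2⟩
  have hcl : s ∈ closure (Ico 0 s) := by
    rw [closure_Ico hs0.ne]; exact ⟨hs0.le, le_rfl⟩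
  exact hcs.mem_closure hcl fun t ht => hlt t ht.1 ht.2

/-! ### Safety gives a uniform margin for pseudo-orbits. -/

section Margin

variable {n m : ℕ}
  {f : EuclideanSpace ℝ (Fin n) → EuclideanSpace ℝ (Fin m) → EuclideanSpace ℝ (Fin n)}
  {D : Set (EuclideanSpace ℝ (Fin m))} {X₀ S : Set (EuclideanSpace ℝ (Fin n))} {T : ℝ}
  {F₁ : EuclideanSpace ℝ (Fin n) → EuclideanSpace ℝ (Fin n)}
  {F₂ : EuclideanSpace ℝ (Fin n) → (EuclideanSpace ℝ (Fin m) →L[ℝ] EuclideanSpace ℝ (Fin n))}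
  {B L : ℝ}

/-- Until its first exit time the curve of the truncated field also solves the original equation, so
safety applies to its maximal extension. The extension agrees with the curve only before the exit
time; continuity carries the agreement to that time, where one would lie in `S` and the other on its
boundary. -/
lemma IsSafe.mem_of_eq_integral (hsafe : IsSafe f D X₀ S T)
    (hFf : ∀ x ∈ closure S, ∀ d ∈ D, f x d = F₁ x + F₂ x d)
    (hS : IsOpen S) (hX₀S : X₀ ⊆ S) {σ : ℝ} (hσ : σ ∈ Icc 0 T)
    {φ : ℝ → EuclideanSpace ℝ (Fin n)} {d : ℝ → EuclideanSpace ℝ (Fin m)} (hdm : Measurable d)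
    (hdD : ∀ t, d t ∈ D) (hφ0 : φ 0 ∈ X₀) (hφ : ∀ t ∈ Icc 0 σ,
      IntervalIntegrable (fun s => F₁ (φ s) + F₂ (φ s) (d s)) volume 0 t ∧
      φ t = φ 0 + ∫ s in (0 : ℝ)..t, (F₁ (φ s) + F₂ (φ s) (d s))) :
    φ σ ∈ S := by
  by_contra hφσ
  have hcont : ContinuousOn φ (Icc 0 σ) := by
    have := intervalIntegral.continuousOn_primitive_interval'
      (hφ σ ⟨hσ.1, le_rfl⟩).1 left_mem_uIcc
    rw [uIcc_of_le hσ.1] at this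
    exact (continuousOn_const.add this).congr fun t ht => (hφ t ht).2
  obtain ⟨s, hs0, hsσ, hsf, hsS⟩ := exists_first_exit hS hσ.1 hcont (hX₀S hφ0) hφσ
  have hagree : ∀ t, 0 ≤ t → t < s → f (φ t) (d t) = F₁ (φ t) + F₂ (φ t) (d t) :=
    fun t h0 h1 => hFf _ (subset_closure (hsS t h0 h1)) _ (hdD t)
  have hsol : IsSolution f d (φ 0) (s : EReal) φ := by
    refine ⟨by exact_mod_cast hs0, fun t h0 h1 => ?_, fun t h0 h1 => ?_⟩
    · have h1 : t < s := by exact_mod_cast h1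
      refine (hφ t ⟨h0, h1.le.trans hsσ⟩).1.congr fun r hr => ?_
      rw [uIoc_of_le h0] at hr
      exact (hagree r hr.1.le (hr.2.trans_lt h1)).symm
    · have h1 : t < s := by exact_mod_cast h1
      refine (hφ t ⟨h0, h1.le.trans hsσ⟩).2.trans ?_
      congr 1
      refine intervalIntegral.integral_congr fun r hr => ?_
      rw [uIcc_of_le h0] at hr
      exact (hagree r hr.1 (hr.2.trans_lt h1)).symm
  obtain ⟨τ, ψ, hψ, -, hψφ⟩ := hsol.exists_isTrajectory
  obtain ⟨hsτ, hψs⟩ := hsafe _ hφ0 d ⟨hdm, fun t _ => hdD t⟩ τ ψ hψ s ⟨hs0.le, hsσ.trans hσ.2⟩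
  have hne : (𝓝[Ico 0 s] s).NeBot := mem_closure_iff_nhdsWithin_neBot.1 (by
    rw [closure_Ico hs0.ne]; exact ⟨hs0.le, le_rfl⟩)
  have l1 : Tendsto ψ (𝓝[Ico 0 s] s) (𝓝 (ψ s)) :=
    (hψ.isSolution.continuousOn hs0.le hsτ s ⟨hs0.le, le_rfl⟩).mono Ico_subset_Icc_self
  have l2 : Tendsto φ (𝓝[Ico 0 s] s) (𝓝 (φ s)) :=
    (hcont s ⟨hs0.le, hsσ⟩).mono fun t ht => ⟨ht.1, ht.2.le.trans hsσ⟩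
  have e : φ s = ψ s := by
    refine tendsto_nhds_unique (l2.congr' ?_) l1
    filter_upwards [self_mem_nhdsWithin] with t ht
    exact (hψφ t ht.1 (by exact_mod_cast ht.2)).symm
  rw [hS.frontier_eq, e] at hsf
  exact hsf.2 hψs

/-- Pseudo-orbits with short steps that reach the boundary of the safe set have a jump cost bounded
away from zero. -/
lemma IsSafe.exists_margin (hsafe : IsSafe f D X₀ S T) (hF : IsBoundedLipschitz F₁ F₂ D B L)
    (hFf : ∀ x ∈ closure S, ∀ d ∈ D, f x d = F₁ x + F₂ x d)
    (hD : IsCompact D) (hDc : Convex ℝ D) (hDn : D.Nonempty) (hS : IsOpen S)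
    (hSb : Bornology.IsBounded S) (hX₀ : IsCompact X₀) (hX₀S : X₀ ⊆ S) :
    ∃ η > 0, ∃ δ > 0, ∀ x ∈ frontier S, ∀ t ∈ Icc 0 T, ∀ c,
      PseudoOrbit F₁ F₂ D X₀ η (x, t) c → δ ≤ c := by
  -- Failure for `η = δ = 1 / (k + 1)` gives pseudo-orbits to the boundary whose step bounds and
  -- costs both tend to zero.
  by_contra! H
  have hpos : ∀ k : ℕ, 0 < 1 / ((k : ℝ) + 1) := fun k => by positivity
  choose x hx t ht c hc hcδ using fun k : ℕ => H _ (hpos k) _ (hpos k)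
  choose σ φ Δ hφ0 hφx hσt happ using
    fun k => (hc k).exists_isApproxTrajectory hF hDc hDn
  have hlim := tendsto_one_div_add_atTop_nhds_zero_nat (𝕜 := ℝ)
  have hc0 : Tendsto c atTop (𝓝 0) :=
    squeeze_zero (fun k => (hc k).cost_nonneg) (fun k => (hcδ k).le) hlim
  have hfr : IsCompact (frontier S) :=
    hSb.isCompact_closure.of_isClosed_subset isClosed_frontier frontier_subset_closure
  obtain ⟨σ', hσ', φ', Δ', happ', hφ0', hφσ'⟩ := IsApproxTrajectory.exists_limit hF hD hX₀ hfr happ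
    hφ0 hx ht hφx hσt (by simpa using hc0.add (hlim.const_mul B)) hc0
  obtain ⟨d, hdm, hdD, hsol⟩ := happ'.exists_control hF hD hDn
  have := hsafe.mem_of_eq_integral hFf hS hX₀S hσ' hdm hdD hφ0' hsol
  rw [hS.frontier_eq] at hφσ'
  exact hφσ'.2 this

end Margin

/-! ### Local existence for Carathéodory equations. -/

section Existence

variable {E W : Type*} [NormedAddCommGroup E] [NormedSpace ℝ E] [FiniteDimensional ℝ E]
  [NormedAddCommGroup W] [NormedSpace ℝ W] [MeasurableSpace W] [BorelSpace W]
  {F₁ : E → E} {F₂ : E → W →L[ℝ] E} {D : Set W} {B L : ℝ}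

lemma IsBoundedLipschitz.intervalIntegrable [FiniteDimensional ℝ W]
    (hF : IsBoundedLipschitz F₁ F₂ D B L) {d : ℝ → W}
    (hdm : Measurable d) (hdD : ∀ t, d t ∈ D) {φ : ℝ → E} (hφ : Continuous φ) (a b : ℝ) :
    IntervalIntegrable (fun s => F₁ (φ s) + F₂ (φ s) (d s)) volume a b := by
  borelize E
  have hm : StronglyMeasurable (Function.uncurry fun (x : E) (s : ℝ) => F₁ x + F₂ x (d s)) := by
    refine stronglyMeasurable_uncurry_of_continuous_of_stronglyMeasurable (fun s => ?_) fun x => ?_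
    · exact continuous_iff_continuousAt.2 fun x =>
        hF.tendsto (fun _ => hdD s) tendsto_id tendsto_const_nhds
    · exact stronglyMeasurable_const.add
        ((F₂ x).continuous.comp_stronglyMeasurable hdm.stronglyMeasurable)
  have hm' : StronglyMeasurable fun s => F₁ (φ s) + F₂ (φ s) (d s) :=
    hm.comp_measurable (hφ.measurable.prodMk measurable_id)
  refine (intervalIntegrable_const (c := B)).mono_fun hm'.aestronglyMeasurable
    (ae_of_all _ fun s => ?_)
  rw [Real.norm_eq_abs, abs_of_nonneg hF.bound_nonneg]
  exact hF.bound _ _ (hdD s)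

open scoped BoundedContinuousFunction in
/-- Local existence for Carathéodory equations with a bounded Lipschitz right-hand side. -/
lemma IsBoundedLipschitz.exists_local_solution [FiniteDimensional ℝ W]
    (hF : IsBoundedLipschitz F₁ F₂ D B L) {d : ℝ → W}
    (hdm : Measurable d) (hdD : ∀ t, d t ∈ D) (y : E) {h : ℝ} (h0 : 0 ≤ h) (hLh : L * h < 1) :
    ∃ ψ : ℝ → E, Continuous ψ ∧ ∀ t ∈ Icc 0 h,
      ψ t = y + ∫ s in (0 : ℝ)..t, (F₁ (ψ s) + F₂ (ψ s) (d s)) := by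
  have : CompleteSpace E := FiniteDimensional.complete ℝ E
  have hL := hF.lip_nonneg
  have hB := hF.bound_nonneg
  -- Clamping time to `[0, h]` lets the Picard map act on bounded continuous functions on all of
  -- `ℝ`, a complete space, where it contracts by the factor `L * h`.
  let p : ℝ → ℝ := fun t => min (max t 0) h
  have pc : Continuous p := by fun_prop
  have p0 : ∀ t, 0 ≤ p t := fun t => le_min (le_max_right _ _) h0
  have ph : ∀ t, p t ≤ h := fun t => min_le_right _ _
  have hi := fun (ψ : ℝ →ᵇ E) (a b : ℝ) => hF.intervalIntegrable hdm hdD ψ.continuous a b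
  let P : (ℝ →ᵇ E) → (ℝ →ᵇ E) := fun ψ => BoundedContinuousFunction.ofNormedAddCommGroup
    (fun t => y + ∫ s in (0 : ℝ)..p t, (F₁ (ψ s) + F₂ (ψ s) (d s)))
    (continuous_const.add ((intervalIntegral.continuous_primitive (hi ψ) 0).comp pc))
    (‖y‖ + B * h) (fun t => by
      refine (norm_add_le _ _).trans (add_le_add le_rfl ?_)
      refine (intervalIntegral.norm_integral_le_of_norm_le_const
        fun s _ => hF.bound _ _ (hdD s)).trans ?_
      rw [sub_zero, abs_of_nonneg (p0 t)]
      exact mul_le_mul_of_nonneg_left (ph t) hB)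
  have hP : ContractingWith (L * h).toNNReal P := by
    refine ⟨by rw [← NNReal.coe_lt_coe, Real.coe_toNNReal _ (mul_nonneg hL h0)]; exact hLh,
      LipschitzWith.of_dist_le_mul fun ψ₁ ψ₂ => ?_⟩
    rw [Real.coe_toNNReal _ (mul_nonneg hL h0)]
    refine (BoundedContinuousFunction.dist_le (by positivity)).2 fun t => ?_
    change dist (y + ∫ s in (0 : ℝ)..p t, (F₁ (ψ₁ s) + F₂ (ψ₁ s) (d s)))
      (y + ∫ s in (0 : ℝ)..p t, (F₁ (ψ₂ s) + F₂ (ψ₂ s) (d s))) ≤ _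
    rw [dist_add_left, dist_eq_norm, ← intervalIntegral.integral_sub (hi _ _ _) (hi _ _ _)]
    refine (intervalIntegral.norm_integral_le_of_norm_le_const
      (C := L * dist ψ₁ ψ₂) fun s _ => (hF.lip _ _ _ (hdD s)).trans ?_).trans ?_
    · rw [← dist_eq_norm]
      exact mul_le_mul_of_nonneg_left (BoundedContinuousFunction.dist_coe_le_dist s) hL
    · rw [sub_zero, abs_of_nonneg (p0 t), mul_assoc, mul_assoc, mul_comm h]
      exact mul_le_mul_of_nonneg_left (mul_le_mul_of_nonneg_left (ph t) dist_nonneg) hL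
  obtain ⟨ψ, hψ⟩ : ∃ ψ, P ψ = ψ := ⟨hP.fixedPoint, hP.fixedPoint_isFixedPt⟩
  refine ⟨ψ, ψ.continuous, fun t ht => ?_⟩
  have pt : p t = t := by
    simp only [p]; rw [max_eq_left ht.1, min_eq_left ht.2]
  conv_lhs => rw [← hψ]
  change y + ∫ s in (0 : ℝ)..p t, (F₁ (ψ s) + F₂ (ψ s) (d s)) = _
  rw [pt]

end Existence

/-! ### A certificate implies safety. -/

section Backward

variable {n m : ℕ}
  {f₁ : EuclideanSpace ℝ (Fin n) → EuclideanSpace ℝ (Fin n)}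
  {f₂ : EuclideanSpace ℝ (Fin n) → (EuclideanSpace ℝ (Fin m) →L[ℝ] EuclideanSpace ℝ (Fin n))}
  {f : EuclideanSpace ℝ (Fin n) → EuclideanSpace ℝ (Fin m) → EuclideanSpace ℝ (Fin n)}
  {D : Set (EuclideanSpace ℝ (Fin m))} {X₀ S : Set (EuclideanSpace ℝ (Fin n))} {T : ℝ}

/-- A trajectory that stays in a bounded set exists for all times. -/
lemma IsTrajectory.eq_top_of_bounded (hf : LocallyLipschitzUniformly (affineField f₁ f₂) D)
    (hD : IsCompact D) {d : ℝ → EuclideanSpace ℝ (Fin m)} (hd : d ∈ Disturbances D)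
    {x₀ : EuclideanSpace ℝ (Fin n)} {τ : EReal} {φ : ℝ → EuclideanSpace ℝ (Fin n)}
    (hφ : IsTrajectory (affineField f₁ f₂) d x₀ τ φ) {R : ℝ}
    (hR : ∀ t : ℝ, 0 ≤ t → (t : EReal) < τ → ‖φ t‖ ≤ R) : τ = ⊤ := by
  by_contra hτ
  obtain ⟨r, rfl⟩ : ∃ r : ℝ, τ = r :=
    ⟨τ.toReal, (EReal.coe_toReal hτ (bot_lt_of_lt hφ.isSolution.pos).ne').symm⟩
  have hr : 0 < r := by exact_mod_cast hφ.isSolution.pos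
  obtain ⟨F₁, F₂, B, L, hF, hFf⟩ := hf.exists_isBoundedLipschitz hD (R + 1)
  have hB := hF.bound_nonneg
  have hL := hF.lip_nonneg
  have hFf' : ∀ x d, ‖x‖ ≤ R + 1 → affineField f₁ f₂ x d = F₁ x + F₂ x d := fun x d hx => by
    rw [(hFf x hx).1, (hFf x hx).2]; rfl
  have hint : ∀ t, 0 ≤ t → t < r →
      IntervalIntegrable (fun s => affineField f₁ f₂ (φ s) (d s)) volume 0 t := fun t h0 ht =>
    hφ.isSolution.integrable t h0 (by exact_mod_cast ht)
  have hbound : ∀ s, 0 ≤ s → s < r → ‖affineField f₁ f₂ (φ s) (d s)‖ ≤ B := fun s h0 hs => by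
    rw [hFf' _ _ ((hR s h0 (by exact_mod_cast hs)).trans (by linarith))]
    exact hF.bound _ _ (hd.2 s h0)
  have hintr : IntervalIntegrable (fun s => affineField f₁ f₂ (φ s) (d s)) volume 0 r := by
    rw [intervalIntegrable_iff_integrableOn_Ioo_of_le hr.le]
    have hmeas : AEStronglyMeasurable (fun s => affineField f₁ f₂ (φ s) (d s))
        (volume.restrict (Ioo 0 r)) := by
      obtain ⟨u, -, hu, hul⟩ := exists_seq_strictMono_tendsto' hr
      -- Integrability is known only on `[0, t]` with `t < r`. Measurability passes to the union,
      -- and the bound `B` then gives integrability up to `r`.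
      have hsub : Ioo 0 r ⊆ ⋃ k, Ioc 0 (u k) := fun s hs => by
        obtain ⟨k, hk⟩ := (hul.eventually (lt_mem_nhds hs.2)).exists
        exact mem_iUnion.2 ⟨k, hs.1, hk.le⟩
      refine AEStronglyMeasurable.mono_set hsub (aestronglyMeasurable_iUnion_iff.2 fun k => ?_)
      exact ((intervalIntegrable_iff_integrableOn_Ioc_of_le (hu k).1.le).1
        (hint _ (hu k).1.le (hu k).2)).aestronglyMeasurable
    refine Integrable.of_bound hmeas B ?_
    exact (ae_restrict_iff' measurableSet_Ioo).2 (ae_of_all _ fun s hs => hbound s hs.1.le hs.2)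
  -- The value `φ r` is arbitrary, so the restart point is the left limit of `φ` at `r`, written as
  -- an integral.
  set y := x₀ + ∫ s in (0 : ℝ)..r, affineField f₁ f₂ (φ s) (d s) with hy
  have hyR : ‖y‖ ≤ R := by
    have hc := intervalIntegral.continuousOn_primitive_interval' hintr left_mem_uIcc
    rw [uIcc_of_le hr.le] at hc
    have h1 : Tendsto (fun t => x₀ + ∫ s in (0 : ℝ)..t, affineField f₁ f₂ (φ s) (d s))
        (𝓝[Ico 0 r] r) (𝓝 y) :=
      ((continuousOn_const.add hc) r ⟨hr.le, le_rfl⟩).mono Ico_subset_Icc_self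
    have hne : (𝓝[Ico 0 r] r).NeBot := mem_closure_iff_nhdsWithin_neBot.1 (by
      rw [closure_Ico hr.ne]; exact ⟨hr.le, le_rfl⟩)
    refine le_of_tendsto h1.norm ?_
    filter_upwards [self_mem_nhdsWithin] with t ht
    have htr : (t : EReal) < r := by exact_mod_cast ht.2
    rw [← hφ.isSolution.eq_integral t ht.1 htr]
    exact hR t ht.1 htr
  -- Short enough both for the contraction, `L * h < 1`, and for `B * h ≤ 1`, which keeps the new
  -- piece in the ball of radius `R + 1` where the truncated field is the original one.
  set h := 1 / (L + B + 1) with hh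
  have hpos : 0 < L + B + 1 := by positivity
  have h0 : 0 < h := by positivity
  have hsum : (L + B + 1) * h = 1 := by rw [hh]; field_simp
  -- The maximum keeps the argument nonnegative, where `d` is known to take values in `D`.
  have hdm : Measurable fun s => d (r + max s 0) := hd.1.comp (by fun_prop)
  have hdD : ∀ s, d (r + max s 0) ∈ D := fun s => hd.2 _ (by positivity)
  obtain ⟨ψ, hψc, hψ⟩ := hF.exists_local_solution hdm hdD y h0.le
    (by nlinarith [mul_nonneg hB h0.le])
  have hψR : ∀ t ∈ Icc 0 h, ‖ψ t‖ ≤ R + 1 := fun t ht => by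
    rw [hψ t ht]
    refine (norm_add_le _ _).trans (add_le_add hyR ?_)
    refine (intervalIntegral.norm_integral_le_of_norm_le_const
      fun s _ => hF.bound _ _ (hdD s)).trans ?_
    rw [sub_zero, abs_of_nonneg ht.1]
    nlinarith [mul_le_mul_of_nonneg_left ht.2 hB, mul_nonneg hL h0.le]
  let φ' : ℝ → EuclideanSpace ℝ (Fin n) := fun t => if t < r then φ t else ψ (t - r)
  have φl : ∀ t, t < r → φ' t = φ t := fun t ht => if_pos ht
  have φr : ∀ t, r ≤ t → φ' t = ψ (t - r) := fun t ht => if_neg ht.not_gt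
  have hne : ∀ᵐ s : ℝ, s ≠ r := by simp [ae_iff, measure_singleton]
  have hae0 : ∀ᵐ s, s ∈ uIoc 0 r →
      affineField f₁ f₂ (φ s) (d s) = affineField f₁ f₂ (φ' s) (d s) := by
    filter_upwards [hne] with s hs hs'
    rw [uIoc_of_le hr.le] at hs'
    rw [φl s (hs'.2.lt_of_ne hs)]
  have hint0 : IntervalIntegrable (fun s => affineField f₁ f₂ (φ' s) (d s)) volume 0 r :=
    hintr.congr_ae ((ae_restrict_iff' measurableSet_uIoc).2 hae0)
  have heq0 : y = x₀ + ∫ s in (0 : ℝ)..r, affineField f₁ f₂ (φ' s) (d s) := by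
    rw [hy, intervalIntegral.integral_congr_ae hae0]
  have hshift : ∀ t, r ≤ t → t ≤ r + h → ∀ s ∈ uIcc r t,
      F₁ (ψ (s - r)) + F₂ (ψ (s - r)) (d (r + max (s - r) 0))
        = affineField f₁ f₂ (φ' s) (d s) := by
    intro t h1 h2 s hs
    rw [uIcc_of_le h1] at hs
    rw [φr s hs.1, max_eq_left (sub_nonneg.2 hs.1), add_sub_cancel,
      hFf' _ _ (hψR _ ⟨sub_nonneg.2 hs.1, by linarith [hs.2]⟩)]
  have hsol : IsSolution (affineField f₁ f₂) d x₀ ((r + h : ℝ) : EReal) φ' := by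
    have hright : ∀ t, r ≤ t → t ≤ r + h →
        IntervalIntegrable (fun s => affineField f₁ f₂ (φ' s) (d s)) volume r t ∧
        ∫ s in r..t, affineField f₁ f₂ (φ' s) (d s) = φ' t - y := by
      intro t h1 h2
      have hi := (hF.intervalIntegrable hdm hdD hψc 0 (t - r)).comp_sub_right r
      rw [zero_add, sub_add_cancel] at hi
      refine ⟨hi.congr fun s hs => hshift t h1 h2 s (uIoc_subset_uIcc hs), ?_⟩
      rw [← intervalIntegral.integral_congr (hshift t h1 h2),
        intervalIntegral.integral_comp_sub_right
          (fun s => F₁ (ψ s) + F₂ (ψ s) (d (r + max s 0))), sub_self, φr t h1,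
        hψ (t - r) ⟨sub_nonneg.2 h1, by linarith⟩, add_sub_cancel_left]
    refine ⟨by exact_mod_cast add_pos hr h0, fun t ht0 ht => ?_, fun t ht0 ht => ?_⟩
    · have ht : t < r + h := by exact_mod_cast ht
      rcases lt_or_ge t r with htr | htr
      · refine (hint t ht0 htr).congr fun s hs => ?_
        rw [uIoc_of_le ht0] at hs
        simp only [φl s (hs.2.trans_lt htr)]
      · exact hint0.trans (hright t htr ht.le).1
    · have ht : t < r + h := by exact_mod_cast ht
      rcases lt_or_ge t r with htr | htr
      · rw [φl t htr, hφ.isSolution.eq_integral t ht0 (by exact_mod_cast htr)]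
        congr 1
        refine intervalIntegral.integral_congr fun s hs => ?_
        rw [uIcc_of_le ht0] at hs
        simp only [φl s (hs.2.trans_lt htr)]
      · rw [← intervalIntegral.integral_add_adjacent_intervals hint0 (hright t htr ht.le).1,
          (hright t htr ht.le).2, ← add_assoc, ← heq0]
        abel
  have hle := hφ.maximal _ _ hsol fun t _ ht => φl t (by exact_mod_cast ht)
  have : r + h ≤ r := by exact_mod_cast hle
  linarith

/-- A barrier certificate does not increase along solutions in the closure of the safe set. -/
lemma IsBarrierCertificate.apply_le {v : EuclideanSpace ℝ (Fin n) → ℝ → ℝ}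
    (hv : IsBarrierCertificate f D X₀ S T v) (hT : 0 < T)
    {F₁ : EuclideanSpace ℝ (Fin n) → EuclideanSpace ℝ (Fin n)}
    {F₂ : EuclideanSpace ℝ (Fin n) → (EuclideanSpace ℝ (Fin m) →L[ℝ] EuclideanSpace ℝ (Fin n))}
    {B L : ℝ} (hF : IsBoundedLipschitz F₁ F₂ D B L)
    (hFf : ∀ x ∈ closure S, ∀ d ∈ D, f x d = F₁ x + F₂ x d)
    {d : ℝ → EuclideanSpace ℝ (Fin m)} (hd : d ∈ Disturbances D)
    {x₀ : EuclideanSpace ℝ (Fin n)} {τ : EReal} {φ : ℝ → EuclideanSpace ℝ (Fin n)}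
    (hφ : IsSolution f d x₀ τ φ) {s : ℝ} (hs : s ∈ Icc 0 T) (hsτ : (s : EReal) < τ)
    (hφS : ∀ t ∈ Icc 0 s, φ t ∈ closure S) : v (φ s) s ≤ v x₀ 0 := by
  have hB := hF.bound_nonneg
  have hL := hF.lip_nonneg
  let V : EuclideanSpace ℝ (Fin n) × ℝ → ℝ := fun p => v p.1 p.2
  let K : Set (EuclideanSpace ℝ (Fin n) × ℝ) := univ ×ˢ Icc 0 T
  have hφc := hφ.continuousOn hs.1 hsτ
  have hcurve : ContinuousOn (fun t => (φ t, t)) (Icc 0 s) := hφc.prodMk continuousOn_id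
  have hmaps : MapsTo (fun t => (φ t, t)) (Icc 0 s) K := fun t ht =>
    ⟨mem_univ _, ht.1, ht.2.trans hs.2⟩
  have hwc : ContinuousOn (fun t => v (φ t) t) (Icc 0 s) :=
    hv.contDiffOn.continuousOn.comp hcurve hmaps
  have hlt : ∀ t ∈ Icc 0 s, (t : EReal) < τ := fun t ht =>
    lt_of_le_of_lt (by exact_mod_cast ht.2) hsτ
  have hdif : ∀ a b, 0 ≤ a → a ≤ b → b ≤ s →
      IntervalIntegrable (fun r => f (φ r) (d r)) volume a b ∧
      φ b - φ a = ∫ r in a..b, f (φ r) (d r) := by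
    intro a b ha hab hb
    have ia := hφ.integrable a ha (hlt a ⟨ha, hab.trans hb⟩)
    have ib := hφ.integrable b (ha.trans hab) (hlt b ⟨ha.trans hab, hb⟩)
    refine ⟨ia.symm.trans ib, ?_⟩
    rw [hφ.eq_integral a ha (hlt a ⟨ha, hab.trans hb⟩),
      hφ.eq_integral b (ha.trans hab) (hlt b ⟨ha.trans hab, hb⟩), add_sub_add_left_eq_sub,
      intervalIntegral.integral_interval_sub_left ib ia]
  have hspeed : ∀ a b, 0 ≤ a → a ≤ b → b ≤ s → ‖φ b - φ a‖ ≤ B * (b - a) := by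
    intro a b ha hab hb
    rw [(hdif a b ha hab hb).2, ← abs_of_nonneg (sub_nonneg.2 hab)]
    refine intervalIntegral.norm_integral_le_of_norm_le_const fun r hr => ?_
    rw [uIoc_of_le hab] at hr
    have hr0 : 0 ≤ r := ha.trans hr.1.le
    rw [hFf _ (hφS r ⟨hr0, hr.2.trans hb⟩) _ (hd.2 r hr0)]
    exact hF.bound _ _ (hd.2 r hr0)
  -- The solution is differentiable only almost everywhere, so the upper right slope of `v` along it
  -- is bounded at every time instead: it suffices that slopes are eventually below each `r > 0`.
  have key : ∀ t ∈ Icc 0 s, v (φ t) t ≤ v (φ 0) 0 := by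
    refine image_le_of_liminf_slope_right_le_deriv_boundary (B := fun _ => v (φ 0) 0)
      (B' := fun _ => 0) hwc le_rfl continuousOn_const
      (fun t _ => hasDerivWithinAt_const _ _ _) fun a ha r hr => Eventually.frequently ?_
    have haS : a ∈ Icc 0 s := ⟨ha.1, ha.2.le⟩
    have haT : a ∈ Icc 0 T := ⟨ha.1, ha.2.le.trans hs.2⟩
    set A := fderivWithin ℝ V K (φ a, a) with hA
    have hVA : HasFDerivWithinAt V A K (φ a, a) :=
      (hv.contDiffOn.differentiableOn (by norm_num) _ (hmaps haS)).hasFDerivWithinAt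
    have hAd : ∀ e ∈ D, A (F₁ (φ a) + F₂ (φ a) e, 1) ≤ 0 := by
      intro e he
      have h1 : HasDerivWithinAt (fun t => v (φ a) t) (A (0, 1)) (Icc 0 T) a :=
        hVA.comp_hasDerivWithinAt a
          ((hasDerivAt_const a (φ a)).prodMk (hasDerivAt_id a)).hasDerivWithinAt
          fun t ht => ⟨mem_univ _, ht⟩
      have h2 : HasFDerivAt (fun y => v y a) (A.comp (ContinuousLinearMap.inl ℝ _ ℝ)) (φ a) := by
        have h3 : HasFDerivWithinAt (fun y : EuclideanSpace ℝ (Fin n) => (y, a))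
            (ContinuousLinearMap.inl ℝ _ ℝ) univ (φ a) :=
          (hasFDerivAt_prodMk_left (φ a) a).hasFDerivWithinAt
        have h4 : MapsTo (fun y : EuclideanSpace ℝ (Fin n) => (y, a)) univ K :=
          fun y _ => ⟨mem_univ _, haT⟩
        exact (hVA.comp (φ a) h3 h4).hasFDerivAt univ_mem
      have h3 := hv.derivative_nonpos (φ a) (hφS a haS) e he a haT
      rw [h1.derivWithin (uniqueDiffOn_Icc hT a haT), h2.fderiv, hFf _ (hφS a haS) e he,
        ContinuousLinearMap.comp_apply, ContinuousLinearMap.inl_apply, ← map_add] at h3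
      simpa using h3
    set C := ‖A‖ * (L * B) with hC
    have hC0 : 0 ≤ C := by positivity
    -- The state is frozen at `φ a` while the disturbance keeps varying. The certificate inequality
    -- holds at `φ a` for every disturbance value, and freezing changes the integrand by at most `C
    -- * (b - a)`.
    have hAinc : ∀ b, a ≤ b → b ≤ s → A (φ b - φ a, b - a) ≤ C * (b - a) * (b - a) := by
      intro b hab hb
      obtain ⟨hi, he⟩ := hdif a b ha.1 hab hb
      have hi' : IntervalIntegrable (fun r => (f (φ r) (d r), (1 : ℝ))) volume a b := by
        rw [intervalIntegrable_iff] at hi ⊢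
        exact hi.prodMk (intervalIntegrable_iff.1 intervalIntegrable_const)
      have e1 : (φ b - φ a, b - a) = ∫ r in a..b, (f (φ r) (d r), (1 : ℝ)) := by
        rw [intervalIntegral.integral_of_le hab, integral_pair, ← intervalIntegral.integral_of_le hab,
          ← intervalIntegral.integral_of_le hab, he]
        · simp
        · exact (intervalIntegrable_iff_integrableOn_Ioc_of_le hab).1 hi
        · exact (intervalIntegrable_iff_integrableOn_Ioc_of_le hab).1 intervalIntegrable_const
      have hiA : IntervalIntegrable (fun r => A (f (φ r) (d r), (1 : ℝ))) volume a b := by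
        rw [intervalIntegrable_iff] at hi' ⊢
        exact A.integrable_comp hi'
      rw [e1, ← A.intervalIntegral_comp_comm hi']
      have e2 : C * (b - a) * (b - a) = ∫ _ in a..b, C * (b - a) := by
        rw [intervalIntegral.integral_const, smul_eq_mul, mul_comm]
      rw [e2]
      refine intervalIntegral.integral_mono_on hab hiA intervalIntegrable_const fun r hr => ?_
      have hr0 : 0 ≤ r := ha.1.trans hr.1
      have hdr := hd.2 r hr0
      rw [hFf _ (hφS r ⟨hr0, hr.2.trans hb⟩) _ hdr]
      have h1 := hAd _ hdr
      have h2 : A (F₁ (φ r) + F₂ (φ r) (d r), 1) - A (F₁ (φ a) + F₂ (φ a) (d r), 1)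
          ≤ ‖A‖ * (L * (B * (b - a))) := by
        rw [← map_sub, Prod.mk_sub_mk, sub_self]
        refine (le_abs_self _).trans ((A.le_opNorm _).trans ?_)
        refine mul_le_mul_of_nonneg_left ?_ (norm_nonneg _)
        rw [Prod.norm_mk, norm_zero, max_eq_left (norm_nonneg _)]
        refine (hF.lip _ _ _ hdr).trans (mul_le_mul_of_nonneg_left ?_ hL)
        refine (hspeed a r ha.1 hr.1 (hr.2.trans hb)).trans (mul_le_mul_of_nonneg_left ?_ hB)
        linarith [hr.2]
      have e3 : C * (b - a) = ‖A‖ * (L * (B * (b - a))) := by rw [hC]; ring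
      linarith
    have htend : Tendsto (fun t => (φ t, t)) (𝓝[>] a) (𝓝[K] (φ a, a)) := by
      have h1 : Tendsto (fun t => (φ t, t)) (𝓝[Icc 0 s] a) (𝓝[K] (φ a, a)) :=
        (hcurve a haS).tendsto_nhdsWithin hmaps
      refine h1.mono_left ?_
      rw [← nhdsWithin_Ioc_eq_nhdsGT ha.2]
      exact nhdsWithin_mono a fun t ht => ⟨ha.1.trans ht.1.le, ht.2⟩
    have hr' : 0 < r := hr
    -- The factor `B + 1` bounds the speed of `t ↦ (φ t, t)`, so the linearization error is at most
    -- `r / 2` times `b - a`; the quadratic term gets the other half.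
    have hlittle := htend.eventually
      (hVA.isLittleO.def (show 0 < r / (2 * (B + 1)) by positivity))
    have hsmall : ∀ᶠ b in 𝓝[>] a, b ∈ Ioo a (min s (a + r / (2 * (C + 1)))) :=
      Ioo_mem_nhdsGT (lt_min ha.2 (lt_add_of_pos_right a (by positivity)))
    filter_upwards [hlittle, hsmall] with b hb1 hb2
    have hab := hb2.1
    have hbs : b ≤ s := hb2.2.le.trans (min_le_left _ _)
    have hba : 0 < b - a := sub_pos.2 hab
    have hbC : (b - a) * (C + 1) < r / 2 := by
      have h1 : b - a < r / (2 * (C + 1)) := by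
        linarith [hb2.2.trans_le (min_le_right s (a + r / (2 * (C + 1))))]
      rw [lt_div_iff₀ (by positivity)] at h1
      linarith
    have hinc := hAinc b hab.le hbs
    have hnorm : ‖(φ b, b) - (φ a, a)‖ ≤ (B + 1) * (b - a) := by
      rw [Prod.mk_sub_mk, Prod.norm_mk, Real.norm_eq_abs, abs_of_pos hba]
      refine max_le ((hspeed a b ha.1 hab.le hbs).trans ?_) ?_ <;> nlinarith
    have hmain : v (φ b) b - v (φ a) a ≤ C * (b - a) * (b - a) + r / 2 * (b - a) := by
      have h1 := (le_abs_self _).trans (hb1.trans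
        (mul_le_mul_of_nonneg_left hnorm (by positivity)))
      have e : r / (2 * (B + 1)) * ((B + 1) * (b - a)) = r / 2 * (b - a) := by field_simp
      rw [e] at h1
      simp only [V, Prod.mk_sub_mk] at h1
      linarith
    rw [slope_def_field, div_lt_iff₀ hba]
    nlinarith
  simpa [hφ.apply_zero] using key s ⟨hs.1, le_rfl⟩

lemma IsBarrierCertificate.isSafe {v : EuclideanSpace ℝ (Fin n) → ℝ → ℝ}
    (hv : IsBarrierCertificate (affineField f₁ f₂) D X₀ S T v) (hT : 0 < T) (hD : IsCompact D)
    (hf : LocallyLipschitzUniformly (affineField f₁ f₂) D) (hS : IsOpen S)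
    (hSb : Bornology.IsBounded S) (hX₀S : X₀ ⊆ S) : IsSafe (affineField f₁ f₂) D X₀ S T := by
  intro x₀ hx₀ d hd τ φ hφ
  obtain ⟨R, hR⟩ := hSb.closure.exists_norm_le
  obtain ⟨F₁, F₂, B, L, hF, hFf⟩ := hf.exists_isBoundedLipschitz hD R
  have hFf' : ∀ x ∈ closure S, ∀ d ∈ D, affineField f₁ f₂ x d = F₁ x + F₂ x d := fun x hx d _ => by
    rw [(hFf x (hR x hx)).1, (hFf x (hR x hx)).2]; rfl
  have hsol := hφ.isSolution
  have hin : ∀ t ∈ Icc 0 T, (t : EReal) < τ → φ t ∈ S := by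
    intro t ht htτ
    by_contra hφt
    obtain ⟨s, hs0, hst, hsf, hsS⟩ := exists_first_exit hS ht.1 (hsol.continuousOn ht.1 htτ)
      (by rw [hsol.apply_zero]; exact hX₀S hx₀) hφt
    have hsT : s ∈ Icc 0 T := ⟨hs0.le, hst.trans ht.2⟩
    have h1 := hv.apply_le hT hF hFf' hd hsol hsT (lt_of_le_of_lt (by exact_mod_cast hst) htτ)
      fun r hr => by
        rcases hr.2.eq_or_lt with rfl | h
        · exact frontier_subset_closure hsf
        · exact subset_closure (hsS r hr.1 h)
    linarith [hv.neg_initial x₀ hx₀, hv.nonneg_frontier _ hsf s hsT]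
  -- A trajectory ending by time `T` would lie in the bounded set `S` throughout, and hence could
  -- not end at all.
  have hτ : (T : EReal) < τ := by
    by_contra! hle
    have := hφ.eq_top_of_bounded hf hD hd (R := R) fun t h0 ht =>
      hR _ (subset_closure (hin t ⟨h0, by exact_mod_cast (ht.trans_le hle).le⟩ ht))
    rw [this, top_le_iff] at hle
    exact EReal.coe_ne_top T hle
  intro t ht
  have htτ : (t : EReal) < τ := lt_of_le_of_lt (by exact_mod_cast ht.2) hτ
  exact ⟨htτ, hin t ht htτ⟩

end Backward

/-! ### Safety implies a certificate; degenerate cases. -/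

section Forward

variable {n m : ℕ}
  {f₁ : EuclideanSpace ℝ (Fin n) → EuclideanSpace ℝ (Fin n)}
  {f₂ : EuclideanSpace ℝ (Fin n) → (EuclideanSpace ℝ (Fin m) →L[ℝ] EuclideanSpace ℝ (Fin n))}
  {D : Set (EuclideanSpace ℝ (Fin m))} {X₀ S : Set (EuclideanSpace ℝ (Fin n))} {T : ℝ}

lemma IsSafe.exists_isBarrierCertificate_of_nonempty (hsafe : IsSafe (affineField f₁ f₂) D X₀ S T)
    (hT : 0 < T) (hD : IsCompact D) (hDc : Convex ℝ D) (hDn : D.Nonempty)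
    (hf : LocallyLipschitzUniformly (affineField f₁ f₂) D) (hS : IsOpen S)
    (hSb : Bornology.IsBounded S) (hX₀ : IsCompact X₀) (hX₀S : X₀ ⊆ S) :
    ∃ v, IsBarrierCertificate (affineField f₁ f₂) D X₀ S T v := by
  -- Without initial points there are no pseudo-orbits and the jump cost carries no information, but
  -- the zero function is then a certificate.
  rcases X₀.eq_empty_or_nonempty with rfl | hX₀n
  · exact ⟨fun _ _ => 0, contDiffOn_const, by simp, by simp, by simp⟩
  obtain ⟨R, hR⟩ := hSb.closure.exists_norm_le
  obtain ⟨F₁, F₂, B, L, hF, hFf⟩ := hf.exists_isBoundedLipschitz hD R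
  have hFf' : ∀ x ∈ closure S, ∀ d ∈ D, affineField f₁ f₂ x d = F₁ x + F₂ x d := fun x hx d _ => by
    rw [(hFf x (hR x hx)).1, (hFf x (hR x hx)).2]; rfl
  obtain ⟨η, hη, δ, hδ, hm⟩ := hsafe.exists_margin hF hFf' hD hDc hDn hS hSb hX₀ hX₀S
  exact exists_isBarrierCertificate hT hF hFf' hX₀n hη hδ hm

/-- If no disturbance is admissible, the certificate of the system at rest will do. -/
lemma IsSafe.exists_isBarrierCertificate (hsafe : IsSafe (affineField f₁ f₂) D X₀ S T)
    (hT : 0 < T) (hD : IsCompact D) (hDc : Convex ℝ D)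
    (hf : LocallyLipschitzUniformly (affineField f₁ f₂) D) (hS : IsOpen S)
    (hSb : Bornology.IsBounded S) (hX₀ : IsCompact X₀) (hX₀S : X₀ ⊆ S) :
    ∃ v, IsBarrierCertificate (affineField f₁ f₂) D X₀ S T v := by
  rcases D.eq_empty_or_nonempty with rfl | hDn
  · have hrest : LocallyLipschitzUniformly (affineField (n := n) (m := m) 0 0) {0} :=
      fun K _ => ⟨0, by simp [affineField]⟩
    have hrest_safe : IsSafe (affineField (n := n) (m := m) 0 0) {0} X₀ S T := by
      intro x₀ hx₀ d hd τ φ hφ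
      have hconst : ∀ t : ℝ, 0 ≤ t → (t : EReal) < τ → φ t = x₀ := fun t h0 ht => by
        simpa [affineField] using hφ.isSolution.eq_integral t h0 ht
      have hτ : τ = ⊤ := hφ.eq_top_of_bounded hrest isCompact_singleton hd (R := ‖x₀‖)
        fun t h0 ht => by rw [hconst t h0 ht]
      intro t ht
      have htτ : (t : EReal) < τ := hτ ▸ EReal.coe_lt_top t
      exact ⟨htτ, by rw [hconst t ht.1 htτ]; exact hX₀S hx₀⟩
    obtain ⟨v, hv⟩ := hrest_safe.exists_isBarrierCertificate_of_nonempty hT isCompact_singleton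
      (convex_singleton 0) (singleton_nonempty 0) hrest hS hSb hX₀ hX₀S
    exact ⟨v, hv.contDiffOn, hv.neg_initial, hv.nonneg_frontier, by simp⟩
  · exact hsafe.exists_isBarrierCertificate_of_nonempty hT hD hDc hDn hf hS hSb hX₀ hX₀S

end Forward

theorem mainTheorem1 (n m : ℕ)
    (f₁ : EuclideanSpace ℝ (Fin n) → EuclideanSpace ℝ (Fin n))
    (f₂ : EuclideanSpace ℝ (Fin n) → (EuclideanSpace ℝ (Fin m) →L[ℝ] EuclideanSpace ℝ (Fin n)))
    (D : Set (EuclideanSpace ℝ (Fin m))) (hD : IsCompact D) (hDconv : Convex ℝ D)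
    (hf : LocallyLipschitzUniformly (affineField f₁ f₂) D)
    (h : EuclideanSpace ℝ (Fin n) → ℝ) (hh : LocallyLipschitz h)
    (S : Set (EuclideanSpace ℝ (Fin n))) (hS : S = {x | h x < 0})
    (hSopen : IsOpen S) (hSbdd : Bornology.IsBounded S)
    (X₀ : Set (EuclideanSpace ℝ (Fin n))) (hX₀ : IsCompact X₀) (hX₀S : X₀ ⊆ S)
    (T : ℝ) (hT : 0 < T) :
    IsSafe (affineField f₁ f₂) D X₀ S T ↔
      ∃ v : EuclideanSpace ℝ (Fin n) → ℝ → ℝ,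
        IsBarrierCertificate (affineField f₁ f₂) D X₀ S T v :=
  ⟨fun hsafe => hsafe.exists_isBarrierCertificate hT hD hDconv hf hSopen hSbdd hX₀ hX₀S,
    fun ⟨_, hv⟩ => hv.isSafe hT hD hf hSopen hSbdd hX₀S⟩
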